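/- For a rational function $A\in\mathbb C(z)$ of degree at least one, viewed as a self-map of $\mathbb{CP}^1$, let $V(A)\subset\mathbb{CP}^1$ be its set of critical values, let $\Sigma(A)$ be the group of Möbius transformations $\mu$ with $A\circ\mu=A$, and let $\Sigma_\infty(A)=\bigcup_{k\ge 1}\Sigma(A^{\circ k})$. 1. Let $A$ be a rational function of degree two. Then $\Sigma(A)=\{\mathrm{id},\mu_A\}$ for a (unique) Möbius transformation $\mu_A\neq\mathrm{id}$, and if $\mu_A(V(A))\cap V(A)=\emptyset$, then $\Sigma_\infty(A)=\Sigma(A)$. 2. Identify the rational functions of degree two $A=P/Q$, $P=az^2+bz+c$, $Q=dz^2+ez+f$, with the points $[a:b:c:d:e:f]$ of $\mathrm{Rat}_2=\mathbb{CP}^5\setminus\{\operatorname{Res}_{2,2,z}(P,Q)=0\}$, where $\operatorname{Res}_{m,n}$ is the resultant of polynomials with formal degrees $m$ and $n$. Set $$W(z)=P'(z)Q(z)-P(z)Q'(z),\qquad R(t)=\operatorname{Res}_{2,2,z}\bigl(W(z),P(z)-Q(z)t\bigr),$$ $$S(t)=\operatorname{Res}_{2,1,z}\Bigl(R(z),\,(cd-af)z+(ce-bf)-\bigl((ae-bd)z+(af-cd)\bigr)t\Bigr),$$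 and let $L=\{ae-bd=0\}$ and $Z=\{\operatorname{Res}_{2,2,t}(R(t),S(t))=0\}$ in $\mathbb{CP}^5$. Then $U=\mathrm{Rat}_2\setminus(L\cup Z)$ is a non-empty Zariski open subset of $\mathrm{Rat}_2$, and every $A\in U$ satisfies $\mu_A(V(A))\cap V(A)=\emptyset$ and $\Sigma_\infty(A)=\Sigma(A)=\{\mathrm{id},\mu_A\}$. -/

import Mathlib

open Polynomial LinearAlgebra.Projectivization

noncomputable section

namespace QuadRat

/-! ## Rational functions as self-maps of the Riemann sphere -/

/-- The Riemann sphere `ℂ ∪ {∞}`. -/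
abbrev Sphere : Type := OnePoint ℂ

/-- The degree of a rational function `A = P / Q` in lowest terms: `max (deg P) (deg Q)`. -/
def ratDegree (A : RatFunc ℂ) : ℕ := max A.num.natDegree A.denom.natDegree

/-- The point of the sphere with homogeneous coordinates `[p : q]`. -/
def ratio (p q : ℂ) : Sphere := if q = 0 then OnePoint.infty else ((p / q : ℂ) : OnePoint ℂ)

/-- The self-map of the sphere given by a rational function `A = P / Q` in lowest terms. At a finite
point `z` it is `[P(z) : Q(z)]`, and at `∞` it is the ratio of the coefficients of degree
`ratDegree A`. -/
def toMap (A : RatFunc ℂ) : Sphere → Sphere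
  | OnePoint.infty => ratio (A.num.coeff (ratDegree A)) (A.denom.coeff (ratDegree A))
  | OnePoint.some z => ratio (A.num.eval z) (A.denom.eval z)

/-- The polynomial whose roots are the finite points over `w`: `P - w Q` for finite `w`, and `Q` for
`w = ∞`. -/
def fibrePoly (A : RatFunc ℂ) : Sphere → ℂ[X]
  | OnePoint.infty => A.denom
  | OnePoint.some w => A.num - C w * A.denom

/-- The multiplicity (local degree) of `A` at a point of the sphere. At a finite point it is
the multiplicity as a root of the fibre polynomial; at `∞` it is the drop of the degree of the fibre
polynomial below `ratDegree A`. -/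
def multiplicityAt (A : RatFunc ℂ) : Sphere → ℕ
  | OnePoint.infty => ratDegree A - (fibrePoly A (toMap A OnePoint.infty)).natDegree
  | OnePoint.some z => (fibrePoly A (toMap A (z : OnePoint ℂ))).rootMultiplicity z

/-- The set of critical points: the points of multiplicity at least two. -/
def criticalPoints (A : RatFunc ℂ) : Set Sphere := {z | 2 ≤ multiplicityAt A z}

/-- The set `V(A)` of critical values. -/
def criticalValues (A : RatFunc ℂ) : Set Sphere := toMap A '' criticalPoints A

/-! ## Möbius transformations and symmetry groups -/

/-- The group of Möbius transformations `z ↦ (a z + b) / (c z + d)`, as permutations of the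
sphere. -/
def mobiusGroup : Subgroup (Equiv.Perm Sphere) :=
  (MulAction.toPermHom (GL (Fin 2) ℂ) (OnePoint ℂ)).range

/-- The group `Σ(f)` of Möbius transformations `μ` with `f ∘ μ = f`. -/
def symmetryGroup (f : Sphere → Sphere) : Subgroup (Equiv.Perm Sphere) where
  carrier := {μ | μ ∈ mobiusGroup ∧ f ∘ μ = f}
  one_mem' := ⟨one_mem _, rfl⟩
  mul_mem' := by
    rintro μ ν ⟨hμ, hμf⟩ ⟨hν, hνf⟩
    refine ⟨mul_mem hμ hν, ?_⟩
    rw [Equiv.Perm.coe_mul, ← Function.comp_assoc, hμf, hνf]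
  inv_mem' := by
    rintro μ ⟨hμ, hμf⟩
    refine ⟨inv_mem hμ, ?_⟩
    funext z
    have h := congrFun hμf (μ⁻¹ z)
    simpa using h.symm

/-- The union `Σ_∞(A)` of the groups `Σ(A^{∘k})`, `k ≥ 1`. -/
def symmetryInfty (A : RatFunc ℂ) : Set (Equiv.Perm Sphere) :=
  {μ | ∃ k : ℕ, 1 ≤ k ∧ μ ∈ symmetryGroup ((toMap A)^[k])}

open Classical in
/-- The Möbius transformation `μ_A`: the non-identity element of `Σ(A)`, which is unique if `A` has
degree two. (It is set to be the identity if `Σ(A)` is trivial.) -/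
def muA (A : RatFunc ℂ) : Equiv.Perm Sphere :=
  if h : ∃ μ ∈ symmetryGroup (toMap A), μ ≠ 1 then h.choose else 1

/-! ## The variety of rational functions of degree two -/

/-- The projective space `ℂℙ⁵` of sextuples `[a : b : c : d : e : f]`. -/
abbrev P5 : Type := ℙ ℂ (Fin 6 → ℂ)

/-- The numerator `P = a z² + b z + c`. -/
def numPoly (v : Fin 6 → ℂ) : ℂ[X] := C (v 0) * X ^ 2 + C (v 1) * X + C (v 2)

/-- The denominator `Q = d z² + e z + f`. -/
def denPoly (v : Fin 6 → ℂ) : ℂ[X] := C (v 3) * X ^ 2 + C (v 4) * X + C (v 5)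

/-- The rational function `(a z² + b z + c) / (d z² + e z + f)`. -/
def ratOfVec (v : Fin 6 → ℂ) : RatFunc ℂ :=
  algebraMap ℂ[X] (RatFunc ℂ) (numPoly v) / algebraMap ℂ[X] (RatFunc ℂ) (denPoly v)

lemma ratOfVec_smul (t : ℂ) (ht : t ≠ 0) (v : Fin 6 → ℂ) : ratOfVec (t • v) = ratOfVec v := by
  have h1 : numPoly (t • v) = C t * numPoly v := by simp [numPoly]; ring
  have h2 : denPoly (t • v) = C t * denPoly v := by simp [denPoly]; ring
  have h3 : algebraMap ℂ[X] (RatFunc ℂ) (C t) ≠ 0 := by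
    simpa using ht
  rw [ratOfVec, h1, h2, map_mul, map_mul, mul_div_mul_left _ _ h3, ratOfVec]

/-- The rational function with a given projective vector of coefficients. -/
def ratOf : P5 → RatFunc ℂ :=
  Projectivization.lift (fun v => ratOfVec v.1) (by
    rintro ⟨a, ha⟩ ⟨b, hb⟩ t (rfl : a = t • b)
    refine ratOfVec_smul t ?_ b
    rintro rfl
    simp at ha)

/-- `Rat₂`: the complement in `ℂℙ⁵` of the hypersurface `Res_{2,2,z}(P, Q) = 0`. -/
def Rat2 : Set P5 := {x | resultant (numPoly x.rep) (denPoly x.rep) 2 2 ≠ 0}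

/-- A Zariski closed subset of `ℂℙ⁵`: the common zeros of a set of homogeneous polynomials. -/
def IsZariskiClosed (Z : Set P5) : Prop :=
  ∃ S : Set (MvPolynomial (Fin 6) ℂ), (∀ p ∈ S, ∃ d, p.IsHomogeneous d) ∧
    ∀ (v : Fin 6 → ℂ) (hv : v ≠ 0),
      Projectivization.mk ℂ v hv ∈ Z ↔ ∀ p ∈ S, MvPolynomial.eval v p = 0

/-- A Zariski open subset of `Rat₂`: the complement in `Rat₂` of a Zariski closed subset of
`ℂℙ⁵`. -/
def IsZariskiOpenInRat2 (U : Set P5) : Prop := ∃ Z, IsZariskiClosed Z ∧ U = Rat2 \ Z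

/-! ## The open set cut out by resultants -/

/-- The Wronskian `W = P' Q - P Q'`; its coefficient of degree two is `a e - b d`. -/
def wronskianPoly (v : Fin 6 → ℂ) : ℂ[X] :=
  derivative (numPoly v) * denPoly v - numPoly v * derivative (denPoly v)

/-- `R(t) = Res_{2,2,z}(W(z), P(z) - Q(z) t)`. The inner variable of `ℂ[X][X]` is `t` and the outer
variable is `z`. -/
def polyR (v : Fin 6 → ℂ) : ℂ[X] :=
  resultant ((wronskianPoly v).map C) ((numPoly v).map C - C X * (denPoly v).map C) 2 2

/-- The numerator `(cd - af) z + (ce - bf)` of the explicit formula for `μ_A`. -/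
def muNum (v : Fin 6 → ℂ) : ℂ[X] :=
  C (v 2 * v 3 - v 0 * v 5) * X + C (v 2 * v 4 - v 1 * v 5)

/-- The denominator `(ae - bd) z + (af - cd)` of the explicit formula for `μ_A`. -/
def muDen (v : Fin 6 → ℂ) : ℂ[X] :=
  C (v 0 * v 4 - v 1 * v 3) * X + C (v 0 * v 5 - v 2 * v 3)

/-- `S(t) = Res_{2,1,z}(R(z), (cd - af) z + (ce - bf) - ((ae - bd) z + (af - cd)) t)`. -/
def polyS (v : Fin 6 → ℂ) : ℂ[X] :=
  resultant ((polyR v).map C) ((muNum v).map C - C X * (muDen v).map C) 2 1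

/-- The hypersurface `L : a e - b d = 0`. -/
def setL : Set P5 := {x | x.rep 0 * x.rep 4 - x.rep 1 * x.rep 3 = 0}

/-- The hypersurface `Z : Res_{2,2,t}(R(t), S(t)) = 0`. -/
def setZ : Set P5 := {x | resultant (polyR x.rep) (polyS x.rep) 2 2 = 0}

end QuadRat

end

open QuadRat

namespace QuadRat

/-! ## Four squares in a pencil of polynomials -/

/-! A function of degree two has the form `α ∘ z² ∘ β` with `α`, `β` Möbius (`exists_normalForm`).
Hence `F ∘ f = F ∘ g` forces `(β f)² = (β g)²`, so `f = g` or `f = μ g` with `μ = β⁻¹ ∘ (-z) ∘ β`.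
With `g = id` this gives `Σ(F) = {id, μ}`.

For iterates, let `F^[k+2] ∘ σ = F^[k+2]`. Cancelling the outer `F` leaves `F^[k+1] ∘ σ = F^[k+1]`,
which is handled by induction, or `F^[k+1] ∘ σ = μ ∘ F^[k+1]`. In the second case put `f = β F^[k]`,
`f' = f ∘ σ` and `ν = α⁻¹ μ α`; then `f'² = ν(f²)`. The critical values are `α 0` and `α ∞`, so
disjointness says that `ν` moves `{0, ∞}` off itself, that is, every entry of `ν` is nonzero.
Writing `f = p / q`, both `ν₀₀ p² + ν₀₁ q²` and `ν₁₀ p² + ν₁₁ q²` must be squares. Each splits into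
two coprime linear factors, so four pairwise independent combinations of `p` and `q` are squares. A
descent on the degree (`natDegree_eq_zero_of_four_squares`) makes `f` constant, although it is
surjective.

For the open set, the roots of `R` include the critical values and the roots of `S` include their
images under `μ_A`. A point of `μ_A(V(A)) ∩ V(A)` is then a common root, so `Res(R, S) = 0`. -/

lemma isSquare_of_associated_sq {p u : ℂ[X]} (h : Associated (u ^ 2) p) : IsSquare p := by
  obtain ⟨c, hc⟩ := h
  obtain ⟨k, hk, hk'⟩ := Polynomial.isUnit_iff.1 c.isUnit
  obtain ⟨s, hs⟩ := IsAlgClosed.exists_pow_nat_eq k (n := 2) (by norm_num)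
  refine ⟨u * C s, ?_⟩
  rw [← hc, ← hk', ← hs, C_pow]
  ring

lemma isSquare_left_of_isCoprime {p q : ℂ[X]} (hpq : IsCoprime p q) (h : IsSquare (p * q)) :
    IsSquare p := by
  obtain ⟨u, hu⟩ := h
  obtain ⟨d, hd⟩ := exists_associated_pow_of_mul_eq_pow' (k := 2) hpq (by rw [hu, sq])
  exact isSquare_of_associated_sq hd

lemma isCoprime_linear_comb {p q : ℂ[X]} (hpq : IsCoprime p q) {a b c d : ℂ}
    (h : a * d - b * c ≠ 0) : IsCoprime (C a * p + C b * q) (C c * p + C d * q) := by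
  obtain ⟨x, y, hxy⟩ := hpq
  have hC : C (a * d - b * c)⁻¹ * (C a * C d - C b * C c) = 1 := by
    rw [← C_mul, ← C_mul, ← C_sub, ← C_mul, inv_mul_cancel₀ h, C_1]
  refine ⟨C (a * d - b * c)⁻¹ * (C d * x - C c * y), C (a * d - b * c)⁻¹ * (C a * y - C b * x), ?_⟩
  linear_combination (x * p + y * q) * hC + hxy

/-- Over `ℂ` the form splits as `(s p + t q)(s p - t q)`. The factors are coprime because the
determinant `-2 s t` is nonzero, so each of them is a square. -/
lemma exists_isSquare_factors {p q : ℂ[X]} (hpq : IsCoprime p q) {a b : ℂ} (ha : a ≠ 0)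
    (hb : b ≠ 0) (h : IsSquare (C a * p ^ 2 + C b * q ^ 2)) :
    ∃ s t : ℂ, s ^ 2 = a ∧ t ^ 2 = -b ∧ IsSquare (C s * p + C t * q) ∧
      IsSquare (C s * p + C (-t) * q) := by
  obtain ⟨s, hs⟩ := IsAlgClosed.exists_pow_nat_eq a (n := 2) (by norm_num)
  obtain ⟨t, ht⟩ := IsAlgClosed.exists_pow_nat_eq (-b) (n := 2) (by norm_num)
  have hs0 : s ≠ 0 := by rintro rfl; exact ha (by simpa using hs.symm)
  have ht0 : t ≠ 0 := by rintro rfl; exact hb (by simpa using ht.symm)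
  have hfac : C a * p ^ 2 + C b * q ^ 2 = (C s * p + C t * q) * (C s * p + C (-t) * q) := by
    rw [show b = -t ^ 2 by rw [ht]; ring, ← hs]
    simp only [C_neg, C_pow]
    ring
  have hcop : IsCoprime (C s * p + C t * q) (C s * p + C (-t) * q) := by
    refine isCoprime_linear_comb hpq ?_
    have : s * -t - t * s = -2 * (s * t) := by ring
    rw [this]
    simp [hs0, ht0]
  rw [hfac] at h
  exact ⟨s, t, hs, ht, isSquare_left_of_isCoprime hcop h,
    isSquare_left_of_isCoprime hcop.symm (by rwa [mul_comm])⟩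

lemma natDegree_linear_comb_le {p q : ℂ[X]} {n : ℕ} (hp : p.natDegree ≤ n) (hq : q.natDegree ≤ n)
    (a b : ℂ) : (C a * p + C b * q).natDegree ≤ n :=
  natDegree_add_le_of_degree_le ((natDegree_C_mul_le _ _).trans hp)
    ((natDegree_C_mul_le _ _).trans hq)

/-- Up to sign the determinants are `2 s t`, `2 s' t'` and the two factors of `s² t'² - t² s'²`.
This supplies the independence hypothesis for the four factors produced by two uses of
`exists_isSquare_factors`. -/
lemma isPairwiseIndependent {s t s' t' : ℂ} (hst : s * t ≠ 0) (hst' : s' * t' ≠ 0)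
    (h : s ^ 2 * t' ^ 2 - t ^ 2 * s' ^ 2 ≠ 0) : ∀ i j : Fin 4, i ≠ j →
    (![s, s, s', s'] : Fin 4 → ℂ) i * (![t, -t, t', -t'] : Fin 4 → ℂ) j -
      (![t, -t, t', -t'] : Fin 4 → ℂ) i * (![s, s, s', s'] : Fin 4 → ℂ) j ≠ 0 := by
  have hcross : (s * t' - t * s') * (s * t' + t * s') ≠ 0 := fun h' => h (by
    linear_combination h')
  have hc1 := left_ne_zero_of_mul hcross
  have hc2 := right_ne_zero_of_mul hcross
  have key : ∀ x y : ℂ, x * y ≠ 0 → x * -y - y * x ≠ 0 := fun x y h h' => h (by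
    linear_combination (-1 / 2 : ℂ) * h')
  intro i j hij
  fin_cases i <;> fin_cases j <;> simp at hij ⊢ <;> intro h <;>
    first
    | exact key _ _ hst (by linear_combination h)
    | exact key _ _ hst (by linear_combination -h)
    | exact key _ _ hst' (by linear_combination h)
    | exact key _ _ hst' (by linear_combination -h)
    | exact hc1 (by linear_combination h)
    | exact hc1 (by linear_combination -h)
    | exact hc2 (by linear_combination h)
    | exact hc2 (by linear_combination -h)

/-- If four pairwise non-proportional linear combinations of two coprime complex polynomials are
squares, then the two polynomials are constant. -/
theorem natDegree_eq_zero_of_four_squares (n : ℕ) : ∀ {p q : ℂ[X]}, p.natDegree ≤ n →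
    q.natDegree ≤ n → IsCoprime p q → ∀ a b : Fin 4 → ℂ,
    (∀ i j, i ≠ j → a i * b j - b i * a j ≠ 0) →
    (∀ i, IsSquare (C (a i) * p + C (b i) * q)) → p.natDegree = 0 ∧ q.natDegree = 0 := by
  induction n using Nat.strong_induction_on with
  | _ n ih =>
  intro p q hp hq hpq a b hab hsq
  rcases Nat.eq_zero_or_pos n with rfl | hn
  · omega
  -- Descent: `p` and `q` are combinations of `u 0 ^ 2` and `u 1 ^ 2`. The other two squares then
  -- split into four linear factors in `u 0` and `u 1`, which are again squares, in a pencil of at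
  -- most half the degree.
  choose u hu using hsq
  have hdeg : ∀ i, (u i).natDegree ≤ n / 2 := by
    intro i
    have h := natDegree_linear_comb_le hp hq (a i) (b i)
    rw [hu, ← sq, natDegree_pow] at h
    omega
  have hd := hab 0 1 (by decide)
  set δ := a 0 * b 1 - b 0 * a 1 with hδ
  have hC : C δ⁻¹ * (C (a 0) * C (b 1) - C (b 0) * C (a 1)) = 1 := by
    rw [← C_mul, ← C_mul, ← C_sub, ← C_mul, inv_mul_cancel₀ hd, C_1]
  -- Cramer's rule for the system given by the squares with indices 0 and 1.
  have hpu : p = C (δ⁻¹ * b 1) * u 0 ^ 2 + C (-δ⁻¹ * b 0) * u 1 ^ 2 := by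
    rw [sq, sq, ← hu, ← hu]
    simp only [C_mul, C_neg]
    linear_combination (-p) * hC
  have hqu : q = C (-δ⁻¹ * a 1) * u 0 ^ 2 + C (δ⁻¹ * a 0) * u 1 ^ 2 := by
    rw [sq, sq, ← hu, ← hu]
    simp only [C_mul, C_neg]
    linear_combination (-q) * hC
  have hcop : IsCoprime (u 0) (u 1) := by
    have h := isCoprime_linear_comb hpq hd
    rw [hu, hu, ← sq, ← sq] at h
    exact (IsCoprime.pow_iff (by norm_num) (by norm_num)).1 h
  have hexp : ∀ i, C (δ⁻¹ * (a i * b 1 - b i * a 1)) * u 0 ^ 2 +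
      C (δ⁻¹ * (a 0 * b i - b 0 * a i)) * u 1 ^ 2 = u i * u i := by
    intro i
    rw [← hu i]
    conv_rhs => rw [hpu, hqu]
    simp only [C_mul, C_neg, C_sub]
    ring
  have hne : ∀ i, i ≠ 0 → i ≠ 1 → δ⁻¹ * (a i * b 1 - b i * a 1) ≠ 0 ∧
      δ⁻¹ * (a 0 * b i - b 0 * a i) ≠ 0 := fun i h0 h1 =>
    ⟨mul_ne_zero (inv_ne_zero hd) (hab _ _ h1), mul_ne_zero (inv_ne_zero hd) (hab _ _ h0.symm)⟩
  obtain ⟨s, t, hs, ht, h1, h2⟩ := exists_isSquare_factors hcop (hne 2 (by decide) (by decide)).1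
    (hne 2 (by decide) (by decide)).2 ⟨_, hexp 2⟩
  obtain ⟨s', t', hs', ht', h3, h4⟩ := exists_isSquare_factors hcop
    (hne 3 (by decide) (by decide)).1 (hne 3 (by decide) (by decide)).2 ⟨_, hexp 3⟩
  have hst : s * t ≠ 0 := by
    intro h
    have := congrArg (· ^ 2) h
    simp only [mul_pow, hs, ht] at this
    have h1 := hne 2 (by decide) (by decide)
    simp_all
  have hst' : s' * t' ≠ 0 := by
    intro h
    have := congrArg (· ^ 2) h
    simp only [mul_pow, hs', ht'] at this
    have h1 := hne 3 (by decide) (by decide)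
    simp_all
  have hcross : s ^ 2 * t' ^ 2 - t ^ 2 * s' ^ 2 ≠ 0 := by
    rw [hs, ht, hs', ht']
    have h : δ⁻¹ * (a 2 * b 1 - b 2 * a 1) * -(δ⁻¹ * (a 0 * b 3 - b 0 * a 3)) -
        -(δ⁻¹ * (a 0 * b 2 - b 0 * a 2)) * (δ⁻¹ * (a 3 * b 1 - b 3 * a 1)) =
        -(δ⁻¹ ^ 2 * δ * (a 2 * b 3 - b 2 * a 3)) := by
      rw [hδ]
      ring
    rw [h]
    exact neg_ne_zero.2 (mul_ne_zero (mul_ne_zero (pow_ne_zero _ (inv_ne_zero hd)) hd)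
      (hab 2 3 (by decide)))
  obtain ⟨e0, e1⟩ := ih (n / 2) (by omega) (hdeg 0) (hdeg 1) hcop ![s, s, s', s'] ![t, -t, t', -t']
    (isPairwiseIndependent hst hst' hcross)
    (by intro i; fin_cases i <;> assumption)
  have hz : ∀ i : Fin 4, (u i).natDegree = 0 → (u i ^ 2).natDegree ≤ 0 := fun i h => by
    rw [natDegree_pow, h]
  constructor
  · rw [hpu]
    exact Nat.le_zero.1 (natDegree_linear_comb_le (hz 0 e0) (hz 1 e1) _ _)
  · rw [hqu]
    exact Nat.le_zero.1 (natDegree_linear_comb_le (hz 0 e0) (hz 1 e1) _ _)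

/-! ## Homogeneous coordinates on the Riemann sphere -/

lemma ratio_zero_right (p : ℂ) : ratio p 0 = OnePoint.infty := by simp [ratio]

lemma ratio_one_right (z : ℂ) : ratio z 1 = (z : OnePoint ℂ) := by simp [ratio]

lemma exists_eq_ratio (z : Sphere) : ∃ p q : ℂ, (p ≠ 0 ∨ q ≠ 0) ∧ z = ratio p q := by
  induction z using OnePoint.rec with
  | infty => exact ⟨1, 0, by simp, by simp [ratio]⟩
  | coe z => exact ⟨z, 1, by simp, by simp [ratio]⟩

lemma ratio_eq_ratio_iff {p q p' q' : ℂ} (h : p ≠ 0 ∨ q ≠ 0) (h' : p' ≠ 0 ∨ q' ≠ 0) :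
    ratio p q = ratio p' q' ↔ p * q' = p' * q := by
  by_cases hq : q = 0 <;> by_cases hq' : q' = 0
  · simp [ratio, hq, hq']
  · have hp : p ≠ 0 := by simpa [hq] using h
    simp [ratio, hq, hq', hp]
  · have hp : p' ≠ 0 := by simpa [hq'] using h'
    simp [ratio, hq, hq', hp]
  · simp only [ratio, hq, hq', if_false, OnePoint.coe_eq_coe]
    rw [div_eq_div_iff hq hq']

lemma ratio_mul_left {k : ℂ} (hk : k ≠ 0) (p q : ℂ) : ratio (k * p) (k * q) = ratio p q := by
  by_cases hq : q = 0
  · simp [ratio, hq]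
  · simp [ratio, hq, hk, mul_div_mul_left]

lemma linear_ne_zero (g : GL (Fin 2) ℂ) {p q : ℂ} (h : p ≠ 0 ∨ q ≠ 0) :
    g 0 0 * p + g 0 1 * q ≠ 0 ∨ g 1 0 * p + g 1 1 * q ≠ 0 := by
  have hdet := g.det_ne_zero
  rw [Matrix.det_fin_two] at hdet
  by_contra! hc
  obtain ⟨h1, h2⟩ := hc
  rcases h with h | h
  · exact mul_ne_zero hdet h (by linear_combination g 1 1 * h1 - g 0 1 * h2)
  · exact mul_ne_zero hdet h (by linear_combination g 0 0 * h2 - g 1 0 * h1)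

lemma smul_ratio (g : GL (Fin 2) ℂ) {p q : ℂ} (h : p ≠ 0 ∨ q ≠ 0) :
    g • ratio p q = ratio (g 0 0 * p + g 0 1 * q) (g 1 0 * p + g 1 1 * q) := by
  have key : ∀ z : ℂ, g • (z : OnePoint ℂ) = ratio (g 0 0 * z + g 0 1) (g 1 0 * z + g 1 1) := by
    intro z
    rw [OnePoint.smul_some_eq_ite]
    rfl
  by_cases hq : q = 0
  · subst hq
    have hp : p ≠ 0 := by simpa using h
    rw [ratio_zero_right, OnePoint.smul_infty_eq_ite, mul_zero, add_zero, mul_zero, add_zero,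
      mul_comm _ p, mul_comm _ p, ratio_mul_left hp]
    rfl
  · have h1 : ratio p q = ((p / q : ℂ) : OnePoint ℂ) := by simp [ratio, hq]
    rw [h1, key, ← ratio_mul_left hq]
    congr 1 <;> field_simp

/-- The squaring map `z ↦ z ^ 2` of the Riemann sphere. -/
def sqMap : Sphere → Sphere
  | OnePoint.infty => OnePoint.infty
  | OnePoint.some z => ((z ^ 2 : ℂ) : OnePoint ℂ)

lemma sqMap_ratio (p q : ℂ) : sqMap (ratio p q) = ratio (p ^ 2) (q ^ 2) := by
  by_cases hq : q = 0
  · simp only [hq, ratio_zero_right, ne_eq, OfNat.ofNat_ne_zero, not_false_eq_true, zero_pow]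
    rfl
  · have h1 : ratio p q = ((p / q : ℂ) : OnePoint ℂ) := by simp [ratio, hq]
    rw [h1]
    simp only [sqMap, ratio, pow_eq_zero_iff, ne_eq, OfNat.ofNat_ne_zero, not_false_eq_true, hq,
      if_false, div_pow]

lemma sqMap_surjective : Function.Surjective sqMap := by
  intro w
  obtain ⟨p, q, -, rfl⟩ := exists_eq_ratio w
  obtain ⟨s, hs⟩ := IsAlgClosed.exists_pow_nat_eq p (n := 2) (by norm_num)
  obtain ⟨t, ht⟩ := IsAlgClosed.exists_pow_nat_eq q (n := 2) (by norm_num)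
  exact ⟨ratio s t, by rw [sqMap_ratio, hs, ht]⟩

/-- The element of `GL(2, ℂ)` with given entries. -/
noncomputable def mkGL (a b c d : ℂ) (h : a * d - b * c ≠ 0) : GL (Fin 2) ℂ :=
  Matrix.GeneralLinearGroup.mkOfDetNeZero !![a, b; c, d] (by rwa [Matrix.det_fin_two_of])

lemma mkGL_smul_ratio {a b c d : ℂ} (h : a * d - b * c ≠ 0) {p q : ℂ} (hpq : p ≠ 0 ∨ q ≠ 0) :
    mkGL a b c d h • ratio p q = ratio (a * p + b * q) (c * p + d * q) :=
  smul_ratio _ hpq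

/-- The transformation `z ↦ -z`. -/
noncomputable def negGL : GL (Fin 2) ℂ := mkGL (-1) 0 0 1 (by norm_num)

/-- The transformation `z ↦ 1 / z`. -/
noncomputable def swapGL : GL (Fin 2) ℂ := mkGL 0 1 1 0 (by norm_num)

lemma negGL_smul_ratio {p q : ℂ} (hpq : p ≠ 0 ∨ q ≠ 0) :
    negGL • ratio p q = ratio (-p) q := by
  rw [negGL, mkGL_smul_ratio _ hpq]
  congr 1 <;> ring

lemma swapGL_smul_ratio {p q : ℂ} (hpq : p ≠ 0 ∨ q ≠ 0) :
    swapGL • ratio p q = ratio q p := by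
  rw [swapGL, mkGL_smul_ratio _ hpq]
  congr 1 <;> ring

lemma sqMap_negGL_smul (z : Sphere) : sqMap (negGL • z) = sqMap z := by
  obtain ⟨p, q, h, rfl⟩ := exists_eq_ratio z
  rw [negGL_smul_ratio h, sqMap_ratio, sqMap_ratio, neg_sq]

lemma negGL_smul_eq_self {z : Sphere} (h : negGL • z = z) : z = ratio 0 1 ∨ z = ratio 1 0 := by
  obtain ⟨p, q, hpq, rfl⟩ := exists_eq_ratio z
  rw [negGL_smul_ratio hpq, ratio_eq_ratio_iff (by simpa using hpq) hpq] at h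
  have h2 : p * q = 0 := by linear_combination (-1 / 2 : ℂ) * h
  rcases mul_eq_zero.1 h2 with rfl | rfl
  · left; rw [ratio_eq_ratio_iff hpq (by simp)]; ring
  · right; rw [ratio_eq_ratio_iff hpq (by simp)]; ring

/-! ## Rational self-maps of the sphere -/

/-- On the finite plane, `f` is the quotient of the coprime polynomials `p` and `q`. -/
def IsQuotient (f : Sphere → Sphere) (p q : ℂ[X]) : Prop :=
  IsCoprime p q ∧ ∀ z : ℂ, f z = ratio (p.eval z) (q.eval z)

/-- `f` is a quotient of coprime polynomials in every affine chart of the source. -/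
def IsRational (f : Sphere → Sphere) : Prop :=
  ∀ σ : GL (Fin 2) ℂ, ∃ p q, IsQuotient (fun z => f (σ • z)) p q

lemma eval_ne_zero_of_isCoprime {p q : ℂ[X]} (h : IsCoprime p q) (z : ℂ) :
    p.eval z ≠ 0 ∨ q.eval z ≠ 0 := by
  obtain ⟨x, y, hxy⟩ := h
  by_contra! hc
  have := congrArg (eval z) hxy
  simp [hc.1, hc.2] at this

lemma IsQuotient.smul {f : Sphere → Sphere} {p q : ℂ[X]} (h : IsQuotient f p q)
    (g : GL (Fin 2) ℂ) : IsQuotient (fun z => g • f z) (C (g 0 0) * p + C (g 0 1) * q)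
      (C (g 1 0) * p + C (g 1 1) * q) := by
  refine ⟨isCoprime_linear_comb h.1 ?_, fun z => ?_⟩
  · rw [← Matrix.det_fin_two]
    exact g.det_ne_zero
  · simp only [h.2 z, smul_ratio g (eval_ne_zero_of_isCoprime h.1 z), eval_add, eval_mul, eval_C]

lemma IsQuotient.sqMap_comp {f : Sphere → Sphere} {p q : ℂ[X]} (h : IsQuotient f p q) :
    IsQuotient (fun z => sqMap (f z)) (p ^ 2) (q ^ 2) := by
  refine ⟨h.1.pow, fun z => ?_⟩
  simp only [h.2 z, sqMap_ratio, eval_pow]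

lemma IsRational.smul {f : Sphere → Sphere} (h : IsRational f) (g : GL (Fin 2) ℂ) :
    IsRational (fun z => g • f z) := fun σ =>
  let ⟨_, _, hpq⟩ := h σ
  ⟨_, _, hpq.smul g⟩

lemma IsRational.sqMap_comp {f : Sphere → Sphere} (h : IsRational f) :
    IsRational (fun z => sqMap (f z)) := fun σ =>
  let ⟨_, _, hpq⟩ := h σ
  ⟨_, _, hpq.sqMap_comp⟩

lemma IsRational.comp_smul {f : Sphere → Sphere} (h : IsRational f) (g : GL (Fin 2) ℂ) :
    IsRational (fun z => f (g • z)) := fun σ => by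
  obtain ⟨p, q, hpq⟩ := h (g * σ)
  exact ⟨p, q, by simpa only [mul_smul] using hpq⟩

lemma isRational_id : IsRational id := by
  have hid : IsQuotient id X 1 := ⟨isCoprime_one_right, fun z => by simp [ratio]⟩
  exact fun σ => ⟨_, _, hid.smul σ⟩

lemma IsQuotient.not_natDegree_eq_zero {f : Sphere → Sphere} {p q : ℂ[X]} (h : IsQuotient f p q)
    (hf : Function.Surjective f) : ¬ (p.natDegree = 0 ∧ q.natDegree = 0) := by
  rintro ⟨hp, hq⟩
  rw [eq_C_of_natDegree_eq_zero hp, eq_C_of_natDegree_eq_zero hq] at h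
  have hconst : ∀ z : ℂ, f z = ratio (p.coeff 0) (q.coeff 0) := fun z => by
    simpa using h.2 z
  -- The value at `∞` is not controlled by `p` and `q`, so `f` takes at most two values; three
  -- distinct points contradict surjectivity.
  have hinf : ∀ w : Sphere, w = ratio (p.coeff 0) (q.coeff 0) ∨ w = f OnePoint.infty := by
    intro w
    obtain ⟨z, rfl⟩ := hf w
    induction z using OnePoint.rec with
    | infty => exact Or.inr rfl
    | coe z => exact Or.inl (hconst z)
  have h01 : ((0 : ℂ) : Sphere) ≠ ((1 : ℂ) : Sphere) := by simp
  have h12 : ((1 : ℂ) : Sphere) ≠ ((2 : ℂ) : Sphere) := by simp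
  have h02 : ((0 : ℂ) : Sphere) ≠ ((2 : ℂ) : Sphere) := by simp
  rcases hinf ((0 : ℂ) : Sphere) with h0 | h0 <;> rcases hinf ((1 : ℂ) : Sphere) with h1 | h1 <;>
    rcases hinf ((2 : ℂ) : Sphere) with h2 | h2 <;> simp_all

/-- Two quotients of polynomials with equal squares agree up to sign on the plane. -/
lemma IsQuotient.eq_or_eq_neg {f g : Sphere → Sphere} {p q p' q' : ℂ[X]} (hf : IsQuotient f p q)
    (hg : IsQuotient g p' q') (h : ∀ z, sqMap (f z) = sqMap (g z)) :
    (∀ z : ℂ, f z = g z) ∨ ∀ z : ℂ, f z = negGL • g z := by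
  have hpoly : (p * q') ^ 2 = (p' * q) ^ 2 := by
    refine Polynomial.funext fun z => ?_
    have hz := h z
    have h1 := eval_ne_zero_of_isCoprime hf.1 z
    have h2 := eval_ne_zero_of_isCoprime hg.1 z
    rw [hf.2, hg.2, sqMap_ratio, sqMap_ratio, ratio_eq_ratio_iff (by simpa using h1)
      (by simpa using h2)] at hz
    simp only [eval_pow, eval_mul]
    linear_combination hz
  -- The sign is global on the plane because `ℂ[X]` is a domain.
  rcases sq_eq_sq_iff_eq_or_eq_neg.1 hpoly with hp | hp
  · left
    intro z
    have h1 := eval_ne_zero_of_isCoprime hf.1 z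
    have h2 := eval_ne_zero_of_isCoprime hg.1 z
    rw [hf.2, hg.2, ratio_eq_ratio_iff h1 h2, ← eval_mul, hp, eval_mul]
  · right
    intro z
    have h1 := eval_ne_zero_of_isCoprime hf.1 z
    have h2 := eval_ne_zero_of_isCoprime hg.1 z
    rw [hf.2, hg.2, negGL_smul_ratio h2, ratio_eq_ratio_iff h1 (by simpa using h2), ← eval_mul, hp,
      eval_neg, eval_mul]
    ring

lemma swapGL_smul_zero : swapGL • ((0 : ℂ) : OnePoint ℂ) = OnePoint.infty := by
  rw [← ratio_one_right, swapGL_smul_ratio (by simp), ratio_zero_right]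

/-- Two rational maps with equal squares agree up to sign. -/
lemma IsRational.eq_or_eq_neg {f g : Sphere → Sphere} (hf : IsRational f) (hg : IsRational g)
    (hs : Function.Surjective g) (h : ∀ z, sqMap (f z) = sqMap (g z)) :
    (∀ z, f z = g z) ∨ ∀ z, f z = negGL • g z := by
  obtain ⟨p, q, hpq⟩ := hf 1
  obtain ⟨p', q', hpq'⟩ := hg 1
  simp only [one_smul] at hpq hpq'
  obtain ⟨r, s, hrs⟩ := hf swapGL
  obtain ⟨r', s', hrs'⟩ := hg swapGL
  -- The signs found in the charts around `0` and around `∞` must agree. Otherwise both relations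
  -- hold on `ℂ \ {0}`, where `g` would take only the values `0` and `∞` fixed by `z ↦ -z`; the
  -- points 1, 2, 3 would then all be values of `g` at `0` or `∞`.
  have hmixed : ∀ e₁ e₂ : Sphere → Sphere, (∀ z : ℂ, f z = e₁ (g z)) →
      (∀ z : ℂ, f (swapGL • z) = e₂ (g (swapGL • z))) →
      (∀ w, e₁ w = e₂ w → w = ratio 0 1 ∨ w = ratio 1 0) → False := by
    intro e₁ e₂ h1 h2 he
    have key : ∀ w : Sphere, w ≠ ratio 0 1 → w ≠ ratio 1 0 →
        w = g OnePoint.infty ∨ w = g ((0 : ℂ) : OnePoint ℂ) := by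
      intro w hw0 hw1
      obtain ⟨z, rfl⟩ := hs w
      by_contra! hc
      induction z using OnePoint.rec with
      | infty => exact hc.1 rfl
      | coe z =>
        have hz : z ≠ 0 := by rintro rfl; exact hc.2 rfl
        have e : (z : OnePoint ℂ) = swapGL • ((z⁻¹ : ℂ) : OnePoint ℂ) := by
          rw [← ratio_one_right, ← ratio_one_right, swapGL_smul_ratio (by simp),
            ratio_eq_ratio_iff (by simp) (by simp)]
          field_simp
        have h3 := h2 z⁻¹
        rw [← e, h1] at h3
        rcases he _ h3 with h4 | h4
        · exact hw0 h4
        · exact hw1 h4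
    have ne : ∀ x : ℂ, x ≠ 0 → (x : Sphere) ≠ ratio 0 1 ∧ (x : Sphere) ≠ ratio 1 0 := by
      intro x hx
      rw [← ratio_one_right]
      constructor <;> rw [Ne, ratio_eq_ratio_iff (by simp) (by simp)] <;> simp [hx]
    have h12 : ((1 : ℂ) : Sphere) ≠ ((2 : ℂ) : Sphere) := by simp
    have h13 : ((1 : ℂ) : Sphere) ≠ ((3 : ℂ) : Sphere) := by simp
    have h23 : ((2 : ℂ) : Sphere) ≠ ((3 : ℂ) : Sphere) := by simp
    have k1 := key _ (ne 1 (by norm_num)).1 (ne 1 (by norm_num)).2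
    have k2 := key _ (ne 2 (by norm_num)).1 (ne 2 (by norm_num)).2
    have k3 := key _ (ne 3 (by norm_num)).1 (ne 3 (by norm_num)).2
    rcases k1 with k1 | k1 <;> rcases k2 with k2 | k2 <;> rcases k3 with k3 | k3 <;>
      first
      | exact h12 (k1.trans k2.symm)
      | exact h13 (k1.trans k3.symm)
      | exact h23 (k2.trans k3.symm)
  have hext : ∀ e : Sphere → Sphere, (∀ z : ℂ, f z = e (g z)) →
      (∀ z : ℂ, f (swapGL • z) = e (g (swapGL • z))) → ∀ z, f z = e (g z) := by
    intro e h1 h2 z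
    induction z using OnePoint.rec with
    | infty => simpa only [swapGL_smul_zero] using h2 0
    | coe z => exact h1 z
  rcases hpq.eq_or_eq_neg hpq' h with h1 | h1 <;>
    rcases hrs.eq_or_eq_neg hrs' (fun z => h _) with h2 | h2
  · exact Or.inl (hext id h1 h2)
  · exact (hmixed id (negGL • ·) h1 h2 fun w hw => negGL_smul_eq_self hw.symm).elim
  · exact (hmixed (negGL • ·) id h1 h2 fun w hw => negGL_smul_eq_self hw).elim
  · exact Or.inr (hext (negGL • ·) h1 h2)

/-- If `f` and `f'` are quotients of polynomials with `f' ^ 2 = ν (f ^ 2)` for a Möbius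
transformation `ν` such that `ν {0, ∞}` and `{0, ∞}` are disjoint, then `f` is constant. -/
lemma IsQuotient.natDegree_eq_zero {f f' : Sphere → Sphere} {p q p' q' : ℂ[X]}
    (hf : IsQuotient f p q) (hf' : IsQuotient f' p' q') (ν : GL (Fin 2) ℂ)
    (hν : ∀ i j, ν i j ≠ 0)
    (h : ∀ z, sqMap (f' z) = ν • sqMap (f z)) :
    p.natDegree = 0 ∧ q.natDegree = 0 := by
  have h1 := hf'.sqMap_comp
  have h2 := hf.sqMap_comp.smul ν
  set u := C (ν 0 0) * p ^ 2 + C (ν 0 1) * q ^ 2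
  set v := C (ν 1 0) * p ^ 2 + C (ν 1 1) * q ^ 2
  have hpoly : p' ^ 2 * v = u * q' ^ 2 := by
    refine Polynomial.funext fun z => ?_
    have hz := h z
    rw [show sqMap (f' z) = _ from h1.2 z, show ν • sqMap (f z) = _ from h2.2 z,
      ratio_eq_ratio_iff (eval_ne_zero_of_isCoprime h1.1 z)
      (eval_ne_zero_of_isCoprime h2.1 z)] at hz
    rw [eval_mul, eval_mul, hz]
  -- Both sides of `p'² / q'² = u / v` are in lowest terms, so numerators and denominators agree up
  -- to units.
  have hu : IsSquare u := isSquare_of_associated_sq (u := p') (associated_of_dvd_dvd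
    (h1.1.dvd_of_dvd_mul_right (Dvd.intro _ hpoly))
    (h2.1.dvd_of_dvd_mul_right (Dvd.intro _ hpoly.symm)))
  have hv : IsSquare v := isSquare_of_associated_sq (u := q') (associated_of_dvd_dvd
    (h1.1.symm.dvd_of_dvd_mul_left (Dvd.intro_left _ hpoly.symm))
    (h2.1.symm.dvd_of_dvd_mul_left (Dvd.intro_left _ hpoly)))
  obtain ⟨s, t, hs, ht, k1, k2⟩ := exists_isSquare_factors hf.1 (hν 0 0) (hν 0 1) hu
  obtain ⟨s', t', hs', ht', k3, k4⟩ := exists_isSquare_factors hf.1 (hν 1 0) (hν 1 1) hv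
  have hdet := ν.det_ne_zero
  rw [Matrix.det_fin_two] at hdet
  refine natDegree_eq_zero_of_four_squares (max p.natDegree q.natDegree) (le_max_left _ _)
    (le_max_right _ _) hf.1 ![s, s, s', s'] ![t, -t, t', -t']
    (isPairwiseIndependent ?_ ?_ ?_) (by intro i; fin_cases i <;> assumption)
  · intro h
    have := congrArg (· ^ 2) h
    simp only [mul_pow, hs, ht] at this
    have h1 := hν 0 0
    have h2 := hν 0 1
    simp_all
  · intro h
    have := congrArg (· ^ 2) h
    simp only [mul_pow, hs', ht'] at this
    have h1 := hν 1 0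
    have h2 := hν 1 1
    simp_all
  · rw [hs, ht, hs', ht']
    intro h
    exact hdet (by linear_combination -h)

/-! ## Symmetries of iterates of `α ∘ z² ∘ β` -/

section NormalForm

variable {F : Sphere → Sphere} {α β : GL (Fin 2) ℂ}

/-- The deck involution `β⁻¹ ∘ (-z) ∘ β` of `α ∘ z² ∘ β`. -/
noncomputable def deckGL (β : GL (Fin 2) ℂ) : GL (Fin 2) ℂ := β⁻¹ * negGL * β

lemma deckGL_smul (β : GL (Fin 2) ℂ) (z : Sphere) : deckGL β • z = β⁻¹ • negGL • β • z := by
  rw [deckGL, mul_smul, mul_smul]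

lemma map_deckGL_smul (hF : ∀ z, F z = α • sqMap (β • z)) (z : Sphere) :
    F (deckGL β • z) = F z := by
  rw [hF, hF, deckGL_smul, smul_inv_smul, sqMap_negGL_smul]

lemma surjective_of_normalForm (hF : ∀ z, F z = α • sqMap (β • z)) : Function.Surjective F := by
  intro w
  obtain ⟨z, hz⟩ := sqMap_surjective (α⁻¹ • w)
  exact ⟨β⁻¹ • z, by rw [hF, smul_inv_smul, hz, smul_inv_smul]⟩

lemma isRational_iterate (hF : ∀ z, F z = α • sqMap (β • z)) (k : ℕ) : IsRational F^[k] := by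
  induction k with
  | zero => exact isRational_id
  | succ k ih =>
    have h := ((ih.smul β).sqMap_comp).smul α
    have e : F^[k + 1] = fun z => α • sqMap (β • F^[k] z) := by
      funext z
      rw [Function.iterate_succ_apply', hF]
    rwa [e]

/-- The solutions `f` of `F ∘ f = F ∘ g`. -/
lemma eq_or_eq_deckGL_smul (hF : ∀ z, F z = α • sqMap (β • z)) {f g : Sphere → Sphere}
    (hf : IsRational f) (hg : IsRational g) (hs : Function.Surjective g)
    (h : ∀ z, F (f z) = F (g z)) : (∀ z, f z = g z) ∨ ∀ z, f z = deckGL β • g z := by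
  have hsq : ∀ z, sqMap (β • f z) = sqMap (β • g z) := fun z => by
    have := h z
    rwa [hF, hF, smul_left_cancel_iff] at this
  rcases (hf.smul β).eq_or_eq_neg (hg.smul β) ((MulAction.surjective β).comp hs) hsq with h1 | h1
  · exact Or.inl fun z => smul_left_cancel β (h1 z)
  · right
    intro z
    rw [deckGL_smul, ← h1 z, inv_smul_smul]

/-- Disjointness of the critical values from their images under the deck involution, in terms of
the entries of the transformation which carries it to the source of `z²`. -/
lemma entries_ne_zero (ν : GL (Fin 2) ℂ)
    (h : ∀ x y : Sphere, (x = ratio 0 1 ∨ x = ratio 1 0) → (y = ratio 0 1 ∨ y = ratio 1 0) →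
      ν • x ≠ y) (i j : Fin 2) : ν i j ≠ 0 := by
  -- The columns of `ν` are homogeneous coordinates of the images of `∞` and `0`; avoiding `0` and
  -- `∞` means that both coordinates are nonzero.
  have h0 : ∀ y, (y = ratio 0 1 ∨ y = ratio 1 0) → ratio (ν 0 1) (ν 1 1) ≠ y := fun y hy => by
    simpa [smul_ratio ν (p := 0) (q := 1) (by simp)] using h (ratio 0 1) y (by simp) hy
  have h1 : ∀ y, (y = ratio 0 1 ∨ y = ratio 1 0) → ratio (ν 0 0) (ν 1 0) ≠ y := fun y hy => by
    simpa [smul_ratio ν (p := 1) (q := 0) (by simp)] using h (ratio 1 0) y (by simp) hy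
  have n0 : ν 0 1 ≠ 0 ∨ ν 1 1 ≠ 0 := by simpa using linear_ne_zero ν (p := 0) (q := 1) (by simp)
  have n1 : ν 0 0 ≠ 0 ∨ ν 1 0 ≠ 0 := by simpa using linear_ne_zero ν (p := 1) (q := 0) (by simp)
  have a := h0 _ (Or.inl rfl)
  have b := h0 _ (Or.inr rfl)
  have c := h1 _ (Or.inl rfl)
  have d := h1 _ (Or.inr rfl)
  rw [Ne, ratio_eq_ratio_iff n0 (by simp)] at a b
  rw [Ne, ratio_eq_ratio_iff n1 (by simp)] at c d
  fin_cases i <;> fin_cases j <;> simp_all <;> tauto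

/-- If the critical values `α 0`, `α ∞` are disjoint from their images under the deck involution,
then every Möbius symmetry of an iterate of `F` is a symmetry of `F`. -/
theorem symmetry_of_iterate (hF : ∀ z, F z = α • sqMap (β • z))
    (hV : ∀ x y : Sphere, (x = ratio 0 1 ∨ x = ratio 1 0) → (y = ratio 0 1 ∨ y = ratio 1 0) →
      deckGL β • α • x ≠ α • y) (σ : GL (Fin 2) ℂ) (k : ℕ)
    (h : ∀ z, F^[k + 1] (σ • z) = F^[k + 1] z) : ∀ z, F (σ • z) = F z := by
  induction k with
  | zero => simpa using h
  | succ k ih =>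
    have hsurj : ∀ k, Function.Surjective F^[k] := fun k => (surjective_of_normalForm hF).iterate k
    -- The outermost `F` is cancelled up to the deck involution.
    rcases eq_or_eq_deckGL_smul hF ((isRational_iterate hF (k + 1)).comp_smul σ)
      (isRational_iterate hF (k + 1)) (hsurj _) (fun z => by
        simpa only [Function.iterate_succ_apply'] using h z) with h1 | h1
    · exact ih h1
    · exfalso
      have hν := entries_ne_zero (α⁻¹ * deckGL β * α) (fun x y hx hy hxy => hV x y hx hy (by
        rw [← hxy, mul_smul, mul_smul, smul_inv_smul]))
      -- One more `F` is peeled off each side: `f = β F^[k]` and `f' = β F^[k] σ` satisfy `f'² =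
      -- ν(f²)`.
      obtain ⟨p, q, hpq⟩ := ((isRational_iterate hF k).smul β) 1
      obtain ⟨p', q', hpq'⟩ := ((isRational_iterate hF k).comp_smul σ).smul β 1
      simp only [one_smul] at hpq hpq'
      refine hpq.not_natDegree_eq_zero ((MulAction.surjective β).comp (hsurj k))
        (hpq.natDegree_eq_zero hpq' (α⁻¹ * deckGL β * α) hν fun z => ?_)
      have h2 := h1 z
      rw [Function.iterate_succ_apply', Function.iterate_succ_apply', hF, hF] at h2
      rw [mul_smul, mul_smul, ← h2, inv_smul_smul]

lemma exists_deckGL_smul_ne (β : GL (Fin 2) ℂ) : ∃ z : Sphere, deckGL β • z ≠ z := by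
  refine ⟨β⁻¹ • ratio 1 1, fun h => ?_⟩
  rw [deckGL_smul, smul_inv_smul, smul_left_cancel_iff] at h
  rw [negGL_smul_ratio (by simp), ratio_eq_ratio_iff (by simp) (by simp)] at h
  norm_num at h

/-- The permutation of the sphere given by a matrix. -/
noncomputable def mobiusPerm (g : GL (Fin 2) ℂ) : Equiv.Perm Sphere :=
  MulAction.toPermHom (GL (Fin 2) ℂ) (OnePoint ℂ) g

@[simp] lemma mobiusPerm_apply (g : GL (Fin 2) ℂ) (z : Sphere) : mobiusPerm g z = g • z := rfl

lemma mem_symmetryGroup_iff {f : Sphere → Sphere} {μ : Equiv.Perm Sphere} :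
    μ ∈ symmetryGroup f ↔ ∃ g, mobiusPerm g = μ ∧ ∀ z, f (g • z) = f z := by
  constructor
  · rintro ⟨⟨g, rfl⟩, h⟩
    exact ⟨g, rfl, fun z => congrFun h z⟩
  · rintro ⟨g, rfl, h⟩
    exact ⟨⟨g, rfl⟩, funext h⟩

/-- This is the cancellation of `F` in `F ∘ g = F ∘ id`. -/
lemma symmetryGroup_eq (hF : ∀ z, F z = α • sqMap (β • z)) :
    (symmetryGroup F : Set (Equiv.Perm Sphere)) = {1, mobiusPerm (deckGL β)} := by
  ext μ
  rw [SetLike.mem_coe, mem_symmetryGroup_iff, Set.mem_insert_iff, Set.mem_singleton_iff]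
  constructor
  · rintro ⟨g, rfl, h⟩
    rcases eq_or_eq_deckGL_smul hF (isRational_id.comp_smul g) isRational_id Function.surjective_id
      h with h1 | h1
    · exact Or.inl (Equiv.ext h1)
    · exact Or.inr (Equiv.ext h1)
  · rintro (rfl | rfl)
    · exact ⟨1, map_one _, fun z => by rw [one_smul]⟩
    · exact ⟨_, rfl, map_deckGL_smul hF⟩

lemma mobiusPerm_deckGL_ne_one (β : GL (Fin 2) ℂ) : mobiusPerm (deckGL β) ≠ 1 := by
  obtain ⟨z, hz⟩ := exists_deckGL_smul_ne β
  exact fun h => hz (DFunLike.congr_fun h z)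

lemma muA_eq {A : RatFunc ℂ} (hA : ∀ z, toMap A z = α • sqMap (β • z)) :
    muA A = mobiusPerm (deckGL β) := by
  have hex : ∃ μ ∈ symmetryGroup (toMap A), μ ≠ 1 := by
    refine ⟨_, ?_, mobiusPerm_deckGL_ne_one β⟩
    rw [← SetLike.mem_coe, symmetryGroup_eq hA]
    simp
  have h1 := hex.choose_spec
  rw [← SetLike.mem_coe, symmetryGroup_eq hA] at h1
  rw [muA, dif_pos hex]
  exact h1.1.resolve_left h1.2

theorem symmetryInfty_eq {A : RatFunc ℂ} (hA : ∀ z, toMap A z = α • sqMap (β • z))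
    (hcrit : ∀ x, (x = ratio 0 1 ∨ x = ratio 1 0) → α • x ∈ criticalValues A)
    (hV : muA A '' criticalValues A ∩ criticalValues A = ∅) :
    symmetryInfty A = symmetryGroup (toMap A) := by
  ext μ
  constructor
  · rintro ⟨k, hk, hμ⟩
    obtain ⟨k, rfl⟩ := Nat.exists_eq_add_of_le' hk
    obtain ⟨g, rfl, hg⟩ := mem_symmetryGroup_iff.1 hμ
    refine mem_symmetryGroup_iff.2 ⟨g, rfl, symmetry_of_iterate hA ?_ g k hg⟩
    intro x y hx hy hxy
    refine (hV ▸ Set.notMem_empty (α • y) : α • y ∉ muA A '' criticalValues A ∩ criticalValues A)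
      ⟨⟨α • x, hcrit x hx, ?_⟩, hcrit y hy⟩
    rw [muA_eq hA, mobiusPerm_apply, hxy]
  · exact fun hμ => ⟨1, le_rfl, by simpa using hμ⟩

end NormalForm

/-! ## Resultants of polynomials of formal degree at most two -/

section Resultant

variable {R : Type*} [CommRing R]

/-- The resultant of the binary quadratic forms with coefficients `a, b, c` and `d, e, f`. -/
def quadRes (a b c d e f : R) : R := (a * f - c * d) ^ 2 - (a * e - b * d) * (b * f - c * e)

lemma resultant_two_two (p q : R[X]) : resultant p q 2 2 =
    quadRes (p.coeff 2) (p.coeff 1) (p.coeff 0) (q.coeff 2) (q.coeff 1) (q.coeff 0) := by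
  have h : sylvester p q 2 2 = !![q.coeff 0, 0, p.coeff 0, 0;
      q.coeff 1, q.coeff 0, p.coeff 1, p.coeff 0;
      q.coeff 2, q.coeff 1, p.coeff 2, p.coeff 1;
      0, q.coeff 2, 0, p.coeff 2] := by
    ext i j
    fin_cases i <;> fin_cases j <;> simp [sylvester, Fin.addCases]
  rw [resultant, h, quadRes]
  simp [Matrix.det_succ_row_zero, Fin.sum_univ_succ, Fin.succAbove]
  ring

lemma resultant_two_one (p q : R[X]) : resultant p q 2 1 =
    p.coeff 2 * q.coeff 0 ^ 2 - p.coeff 1 * q.coeff 0 * q.coeff 1 + p.coeff 0 * q.coeff 1 ^ 2 := by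
  have h : sylvester p q 2 1 = !![q.coeff 0, 0, p.coeff 0;
      q.coeff 1, q.coeff 0, p.coeff 1;
      0, q.coeff 1, p.coeff 2] := by
    ext i j
    fin_cases i <;> fin_cases j <;> simp [sylvester, Fin.addCases]
  rw [resultant, h, Matrix.det_fin_three]
  simp
  ring

end Resultant

/-- Binary quadratic forms with a common zero have vanishing resultant. -/
lemma quadRes_eq_zero {a b c d e f x y : ℂ} (h : x ≠ 0 ∨ y ≠ 0)
    (h1 : a * x ^ 2 + b * x * y + c * y ^ 2 = 0) (h2 : d * x ^ 2 + e * x * y + f * y ^ 2 = 0) :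
    quadRes a b c d e f = 0 := by
  rw [quadRes]
  have k1 : (a * e - b * d) * x ^ 2 = (b * f - c * e) * y ^ 2 := by
    linear_combination e * h1 - b * h2
  -- After cancelling `y` and `x`, `k2` and `k3` form a homogeneous linear system in `(x, y)` with
  -- determinant `-quadRes`.
  have k2 : y * ((a * e - b * d) * x + (a * f - c * d) * y) = 0 := by
    linear_combination a * h2 - d * h1
  have k3 : x * ((a * f - c * d) * x + (b * f - c * e) * y) = 0 := by
    linear_combination f * h1 - c * h2
  by_cases hx : x = 0
  · subst hx
    have hy : y ≠ 0 := by simpa using h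
    have hc : c = 0 := by simpa [hy] using h1
    have hf : f = 0 := by simpa [hy] using h2
    subst hc hf
    ring
  by_cases hy : y = 0
  · subst hy
    have ha : a = 0 := by simpa [hx] using h1
    have hd : d = 0 := by simpa [hx] using h2
    subst ha hd
    ring
  have k2' := (mul_eq_zero.1 k2).resolve_left hy
  have k3' := (mul_eq_zero.1 k3).resolve_left hx
  refine (mul_eq_zero.1 (?_ : (x * y) * _ = 0)).resolve_left (mul_ne_zero hx hy)
  linear_combination (a * f - c * d) * x * k2' - (a * e - b * d) * x * k3'

/-! ## Rational functions of degree two -/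

/-- The form `a x² + b x y + c y²`. -/
noncomputable def numForm (v : Fin 6 → ℂ) (x y : ℂ) : ℂ := v 0 * x ^ 2 + v 1 * x * y + v 2 * y ^ 2

/-- The form `d x² + e x y + f y²`. -/
noncomputable def denForm (v : Fin 6 → ℂ) (x y : ℂ) : ℂ := v 3 * x ^ 2 + v 4 * x * y + v 5 * y ^ 2

/-- The Wronskian as a binary form. -/
noncomputable def wronskianForm (v : Fin 6 → ℂ) (x y : ℂ) : ℂ :=
  (v 0 * v 4 - v 1 * v 3) * x ^ 2 + 2 * (v 0 * v 5 - v 2 * v 3) * x * y +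
    (v 1 * v 5 - v 2 * v 4) * y ^ 2

/-- The resultant of the numerator and the denominator. -/
def resVec {R : Type*} [CommRing R] (v : Fin 6 → R) : R :=
  quadRes (v 0) (v 1) (v 2) (v 3) (v 4) (v 5)

lemma resultant_numPoly_denPoly (v : Fin 6 → ℂ) :
    resultant (numPoly v) (denPoly v) 2 2 = resVec v := by
  rw [resultant_two_two, resVec]
  simp [numPoly, denPoly, coeff_X, coeff_C]

lemma forms_ne_zero {v : Fin 6 → ℂ} (hv : resVec v ≠ 0) {x y : ℂ} (h : x ≠ 0 ∨ y ≠ 0) :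
    numForm v x y ≠ 0 ∨ denForm v x y ≠ 0 := by
  by_contra! hc
  exact hv (quadRes_eq_zero h hc.1 hc.2)

/-- The coefficients of the numerator and the denominator in lowest terms. -/
noncomputable def coeffVec (A : RatFunc ℂ) : Fin 6 → ℂ :=
  ![A.num.coeff 2, A.num.coeff 1, A.num.coeff 0, A.denom.coeff 2, A.denom.coeff 1, A.denom.coeff 0]

lemma eq_quadratic_of_natDegree_le {p : ℂ[X]} (h : p.natDegree ≤ 2) :
    p = C (p.coeff 2) * X ^ 2 + C (p.coeff 1) * X + C (p.coeff 0) := by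
  conv_lhs => rw [p.as_sum_range_C_mul_X_pow' (n := 3) (by omega)]
  simp [Finset.sum_range_succ]
  ring

lemma num_eq {A : RatFunc ℂ} (hA : ratDegree A = 2) : A.num = numPoly (coeffVec A) :=
  eq_quadratic_of_natDegree_le (hA ▸ le_max_left _ _)

lemma denom_eq {A : RatFunc ℂ} (hA : ratDegree A = 2) : A.denom = denPoly (coeffVec A) :=
  eq_quadratic_of_natDegree_le (hA ▸ le_max_right _ _)

/-- Coprimality makes the resultant for the true degrees nonzero. One of the two degrees equals 2,
so raising the other formal degree to 2 only multiplies by a sign and a power of a nonzero leading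
coefficient. -/
lemma resVec_coeffVec_ne_zero {A : RatFunc ℂ} (hA : ratDegree A = 2) : resVec (coeffVec A) ≠ 0 := by
  rw [← resultant_numPoly_denPoly, ← num_eq hA, ← denom_eq hA]
  have hres := resultant_ne_zero _ _ A.isCoprime_num_denom
  have h1 : A.num.natDegree ≤ 2 := hA ▸ le_max_left _ _
  have h2 : A.denom.natDegree ≤ 2 := hA ▸ le_max_right _ _
  have hmax : max A.num.natDegree A.denom.natDegree = 2 := hA
  rcases max_choice A.num.natDegree A.denom.natDegree with h | h <;> rw [hmax] at h
  · obtain ⟨k, hk⟩ := Nat.exists_eq_add_of_le h2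
    rw [← h] at hres
    have hc : A.num.coeff 2 ≠ 0 := by
      rw [h, coeff_natDegree, leadingCoeff_ne_zero]
      rintro h0
      simp [h0] at h
    conv => enter [1, 4]; rw [hk]
    rw [resultant_add_right_deg _ _ _ _ _ le_rfl]
    exact mul_ne_zero (pow_ne_zero _ hc) hres
  · obtain ⟨k, hk⟩ := Nat.exists_eq_add_of_le h1
    rw [← h] at hres
    have hc : A.denom.coeff 2 ≠ 0 := by
      rw [h, coeff_natDegree, leadingCoeff_ne_zero]
      exact A.denom_ne_zero
    conv => enter [1, 3]; rw [hk]
    rw [resultant_add_left_deg _ _ _ _ _ le_rfl]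
    exact mul_ne_zero (mul_ne_zero (pow_ne_zero _ (by norm_num)) (pow_ne_zero _ hc)) hres

lemma eval_numPoly (v : Fin 6 → ℂ) (z : ℂ) : (numPoly v).eval z = numForm v z 1 := by
  simp [numPoly, numForm]

lemma eval_denPoly (v : Fin 6 → ℂ) (z : ℂ) : (denPoly v).eval z = denForm v z 1 := by
  simp [denPoly, denForm]

lemma numForm_mul (v : Fin 6 → ℂ) (k x y : ℂ) :
    numForm v (k * x) (k * y) = k ^ 2 * numForm v x y := by
  simp only [numForm]; ring

lemma denForm_mul (v : Fin 6 → ℂ) (k x y : ℂ) :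
    denForm v (k * x) (k * y) = k ^ 2 * denForm v x y := by
  simp only [denForm]; ring

lemma wronskianForm_mul (v : Fin 6 → ℂ) (k x y : ℂ) :
    wronskianForm v (k * x) (k * y) = k ^ 2 * wronskianForm v x y := by
  simp only [wronskianForm]; ring

lemma toMap_coe {A : RatFunc ℂ} (hA : ratDegree A = 2) (z : ℂ) : toMap A (z : OnePoint ℂ) =
    ratio (numForm (coeffVec A) z 1) (denForm (coeffVec A) z 1) := by
  rw [← eval_numPoly, ← eval_denPoly, ← num_eq hA, ← denom_eq hA]
  rfl

lemma toMap_infty {A : RatFunc ℂ} (hA : ratDegree A = 2) : toMap A OnePoint.infty =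
    ratio (coeffVec A 0) (coeffVec A 3) := by
  change ratio _ _ = _
  rw [hA]
  rfl

lemma ratio_eq_infty_or_coe {x y : ℂ} (h : x ≠ 0 ∨ y ≠ 0) :
    (x ≠ 0 ∧ y = 0) ∨ ∃ k z : ℂ, k ≠ 0 ∧ x = k * z ∧ y = k * 1 := by
  by_cases hy : y = 0
  · exact Or.inl ⟨by simpa [hy] using h, hy⟩
  · exact Or.inr ⟨y, x / y, hy, by field_simp, by ring⟩

lemma toMap_ratio {A : RatFunc ℂ} (hA : ratDegree A = 2) {x y : ℂ} (h : x ≠ 0 ∨ y ≠ 0) :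
    toMap A (ratio x y) = ratio (numForm (coeffVec A) x y) (denForm (coeffVec A) x y) := by
  rcases ratio_eq_infty_or_coe h with ⟨hx, rfl⟩ | ⟨k, z, hk, rfl, rfl⟩
  · rw [ratio_zero_right, toMap_infty hA, ← ratio_mul_left (pow_ne_zero 2 hx)]
    congr 1 <;> simp only [numForm, denForm] <;> ring
  · rw [ratio_mul_left hk, ratio_one_right, toMap_coe hA, numForm_mul, denForm_mul,
      ratio_mul_left (pow_ne_zero 2 hk)]

/-! ### Critical points -/

lemma fibre_ne_zero {v : Fin 6 → ℂ} (hv : resVec v ≠ 0) (w : ℂ) :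
    numPoly v - C w * denPoly v ≠ 0 := by
  intro h
  have h0 := congrArg (coeff · 0) h
  have h1 := congrArg (coeff · 1) h
  have h2 := congrArg (coeff · 2) h
  simp [numPoly, denPoly, coeff_X, coeff_C] at h0 h1 h2
  rw [sub_eq_zero] at h0 h1 h2
  refine hv ?_
  rw [resVec, quadRes, h0, h1, h2]
  ring

/-- A critical point is a double root of its fibre polynomial. For `w = P(z) / Q(z)` finite, the
derivative of `P - w Q` at `z` is `W(z) / Q(z)`; over `∞`, where `Q(z) = 0`, one has `W(z) = -P(z)
Q'(z)`. -/
lemma coe_mem_criticalPoints_iff {A : RatFunc ℂ} (hA : ratDegree A = 2) (z : ℂ) :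
    (z : OnePoint ℂ) ∈ criticalPoints A ↔ wronskianForm (coeffVec A) z 1 = 0 := by
  have hv := resVec_coeffVec_ne_zero hA
  have hne := forms_ne_zero hv (x := z) (y := 1) (by simp)
  change 2 ≤ (fibrePoly A (toMap A (z : OnePoint ℂ))).rootMultiplicity z ↔ _
  rw [toMap_coe hA]
  set v := coeffVec A with hvdef
  by_cases hq : denForm v z 1 = 0
  · have hp : numForm v z 1 ≠ 0 := by simpa [hq] using hne
    rw [hq, ratio_zero_right]
    change 1 < A.denom.rootMultiplicity z ↔ _
    rw [one_lt_rootMultiplicity_iff_isRoot A.denom_ne_zero, denom_eq hA, IsRoot, IsRoot,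
      eval_denPoly, ← hvdef]
    have hw : wronskianForm v z 1 = -numForm v z 1 * (2 * v 3 * z + v 4) := by
      simp only [wronskianForm, numForm, denForm] at *
      linear_combination (2 * v 0 * z + v 1) * hq
    have hd : (derivative (denPoly v)).eval z = 2 * v 3 * z + v 4 := by
      simp [denPoly]; ring
    simp [hq, hw, hd, hp]
  · have hr : ratio (numForm v z 1) (denForm v z 1) =
        ((numForm v z 1 / denForm v z 1 : ℂ) : OnePoint ℂ) := by simp [ratio, hq]
    rw [hr]
    change 1 < (A.num - C _ * A.denom).rootMultiplicity z ↔ _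
    rw [num_eq hA, denom_eq hA, one_lt_rootMultiplicity_iff_isRoot (fibre_ne_zero hv _), IsRoot,
      IsRoot]
    have h0 : eval z (numPoly v - C (numForm v z 1 / denForm v z 1) * denPoly v) = 0 := by
      simp only [eval_sub, eval_mul, eval_C, eval_numPoly, eval_denPoly]
      field_simp
      ring
    have h1 : denForm v z 1 *
        eval z (derivative (numPoly v - C (numForm v z 1 / denForm v z 1) * denPoly v)) =
        wronskianForm v z 1 := by
      have hd : eval z (derivative (numPoly v - C (numForm v z 1 / denForm v z 1) * denPoly v)) =
          (2 * v 0 * z + v 1) - numForm v z 1 / denForm v z 1 * (2 * v 3 * z + v 4) := by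
        simp [denPoly, numPoly]; ring
      rw [hd, mul_sub, ← mul_assoc, mul_div_cancel₀ _ hq]
      simp only [wronskianForm, numForm, denForm]
      ring
    rw [← h1]
    simp [h0, hq]

lemma natDegree_eq_zero_iff_coeff_one {p : ℂ[X]} (h : p.natDegree ≤ 2) (h2 : p.coeff 2 = 0) :
    p.natDegree = 0 ↔ p.coeff 1 = 0 := by
  constructor
  · intro h0
    exact coeff_eq_zero_of_natDegree_lt (by omega)
  · intro h1
    rw [eq_quadratic_of_natDegree_le h, h2, h1]
    simp

/-- The degree-two coefficient of the fibre polynomial through `∞` vanishes by construction. A drop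
by two therefore means that the coefficient of degree one vanishes too, which is the vanishing of
`ae - bd`. -/
lemma infty_mem_criticalPoints_iff {A : RatFunc ℂ} (hA : ratDegree A = 2) :
    (OnePoint.infty : OnePoint ℂ) ∈ criticalPoints A ↔ wronskianForm (coeffVec A) 1 0 = 0 := by
  have hne := forms_ne_zero (resVec_coeffVec_ne_zero hA) (x := 1) (y := 0) (by simp)
  have hw : wronskianForm (coeffVec A) 1 0 =
      A.num.coeff 2 * A.denom.coeff 1 - A.num.coeff 1 * A.denom.coeff 2 := by
    simp [wronskianForm, coeffVec]
  have hP : A.num.natDegree ≤ 2 := hA ▸ le_max_left _ _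
  have hQ : A.denom.natDegree ≤ 2 := hA ▸ le_max_right _ _
  change 2 ≤ ratDegree A - (fibrePoly A (toMap A OnePoint.infty)).natDegree ↔ _
  rw [toMap_infty hA, hA, hw]
  have e : ∀ n : ℕ, 2 ≤ 2 - n ↔ n = 0 := by omega
  rw [e]
  simp only [numForm, denForm, one_pow, mul_one, mul_zero, add_zero, ne_eq, OfNat.ofNat_ne_zero,
    not_false_eq_true, zero_pow] at hne
  change (¬ A.num.coeff 2 = 0 ∨ ¬ A.denom.coeff 2 = 0) at hne
  change (fibrePoly A (ratio (A.num.coeff 2) (A.denom.coeff 2))).natDegree = 0 ↔ _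
  by_cases hq : A.denom.coeff 2 = 0
  · have hp : A.num.coeff 2 ≠ 0 := by simpa [hq] using hne
    rw [hq, ratio_zero_right]
    change A.denom.natDegree = 0 ↔ _
    rw [natDegree_eq_zero_iff_coeff_one hQ hq]
    simp [hp]
  · have hr : ratio (A.num.coeff 2) (A.denom.coeff 2) =
        ((A.num.coeff 2 / A.denom.coeff 2 : ℂ) : OnePoint ℂ) := by simp [ratio, hq]
    rw [hr]
    change (A.num - C _ * A.denom).natDegree = 0 ↔ _
    rw [natDegree_eq_zero_iff_coeff_one]
    · rw [coeff_sub, coeff_C_mul]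
      field_simp
      rw [mul_zero, sub_eq_zero, sub_eq_zero, eq_comm]
    · exact natDegree_sub_le_of_le hP ((natDegree_C_mul_le _ _).trans hQ)
    · rw [coeff_sub, coeff_C_mul]
      field_simp
      ring

lemma ratio_mem_criticalPoints_iff {A : RatFunc ℂ} (hA : ratDegree A = 2) {x y : ℂ}
    (h : x ≠ 0 ∨ y ≠ 0) : ratio x y ∈ criticalPoints A ↔ wronskianForm (coeffVec A) x y = 0 := by
  rcases ratio_eq_infty_or_coe h with ⟨hx, rfl⟩ | ⟨k, z, hk, rfl, rfl⟩
  · have : wronskianForm (coeffVec A) x 0 = x ^ 2 * wronskianForm (coeffVec A) 1 0 := by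
      rw [← wronskianForm_mul, mul_one, mul_zero]
    rw [ratio_zero_right, infty_mem_criticalPoints_iff hA, this]
    simp [hx]
  · rw [ratio_mul_left hk, ratio_one_right, coe_mem_criticalPoints_iff hA, wronskianForm_mul]
    simp [hk]

/-! ### Normal form -/

lemma exists_zeros_of_binary_form {u v w : ℂ} (h : v ^ 2 - u * w ≠ 0) :
    ∃ s t s' t' : ℂ, u * s ^ 2 + 2 * v * s * t + w * t ^ 2 = 0 ∧
      u * s' ^ 2 + 2 * v * s' * t' + w * t' ^ 2 = 0 ∧ s * t' - t * s' ≠ 0 := by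
  by_cases hu : u = 0
  · subst hu
    refine ⟨1, 0, -w, 2 * v, by ring, by ring, ?_⟩
    rintro h'
    exact h (by linear_combination v / 2 * h')
  · obtain ⟨δ, hδ⟩ := IsAlgClosed.exists_pow_nat_eq (v ^ 2 - u * w) (n := 2) (by norm_num)
    refine ⟨-v + δ, u, -v - δ, u, ?_, ?_, ?_⟩
    · linear_combination u * hδ
    · linear_combination u * hδ
    · have hδ0 : δ ≠ 0 := by rintro rfl; exact h (by rw [← hδ]; ring)
      have : (-v + δ) * u - u * (-v - δ) = 2 * (u * δ) := by ring
      rw [this]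
      simp [hu, hδ0]

lemma exists_sq_linear {x y z : ℂ} (h : y ^ 2 - 4 * x * z = 0) :
    ∃ l m : ℂ, l ^ 2 = x ∧ 2 * l * m = y ∧ m ^ 2 = z := by
  obtain ⟨l, hl⟩ := IsAlgClosed.exists_pow_nat_eq x (n := 2) (by norm_num)
  by_cases hl0 : l = 0
  · subst hl0
    obtain ⟨m, hm⟩ := IsAlgClosed.exists_pow_nat_eq z (n := 2) (by norm_num)
    have hx : x = 0 := by simpa using hl.symm
    subst hx
    have hy : y = 0 := by simpa using h
    exact ⟨0, m, by simp, by simp [hy], hm⟩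
  · refine ⟨l, y / (2 * l), hl, by field_simp, ?_⟩
    have hx : x ≠ 0 := by rw [← hl]; exact pow_ne_zero _ hl0
    rw [div_pow, mul_pow, hl]
    field_simp
    linear_combination h

/-- The discriminant of `s P + t Q` is a binary quadratic form in `(s, t)` whose own discriminant is
`16 Res(P, Q) ≠ 0`. So exactly two members of the pencil are squares of linear forms. The two linear
forms are the rows of `β`, and the two pairs `(s, t)` are the rows of `α⁻¹`. -/
theorem exists_normalForm {A : RatFunc ℂ} (hA : ratDegree A = 2) :
    ∃ α β : GL (Fin 2) ℂ, (∀ z, toMap A z = α • sqMap (β • z)) ∧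
      ∀ z, z ∈ criticalPoints A ↔ β • z = ratio 0 1 ∨ β • z = ratio 1 0 := by
  have hv := resVec_coeffVec_ne_zero hA
  have hmap := fun x y h => toMap_ratio hA (x := x) (y := y) h
  have hcrit := fun x y h => ratio_mem_criticalPoints_iff hA (x := x) (y := y) h
  set v := coeffVec A
  obtain ⟨s, t, s', t', h1, h2, hN⟩ := exists_zeros_of_binary_form
    (u := v 1 ^ 2 - 4 * v 0 * v 2) (v := v 1 * v 4 - 2 * v 0 * v 5 - 2 * v 2 * v 3)
    (w := v 4 ^ 2 - 4 * v 3 * v 5) (fun h => hv (by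
      rw [resVec, quadRes]
      linear_combination (1 / 4 : ℂ) * h))
  obtain ⟨l, m, e1, e2, e3⟩ := exists_sq_linear (x := s * v 0 + t * v 3)
    (y := s * v 1 + t * v 4) (z := s * v 2 + t * v 5) (by linear_combination h1)
  obtain ⟨l', m', f1, f2, f3⟩ := exists_sq_linear (x := s' * v 0 + t' * v 3)
    (y := s' * v 1 + t' * v 4) (z := s' * v 2 + t' * v 5) (by linear_combination h2)
  -- `k1`, `k2`, `k3` compare coefficients in the Wronskian of `s P + t Q = L²` and `s' P + t' Q =
  -- L'²`, computed in both ways.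
  have k1 : (s * t' - t * s') * (v 0 * v 4 - v 1 * v 3) = 2 * l * l' * (l * m' - m * l') := by
    linear_combination (s * v 1 + t * v 4) * f1 + l' ^ 2 * e2 - (s' * v 1 + t' * v 4) * e1 -
      l ^ 2 * f2
  have k2 : (s * t' - t * s') * (v 0 * v 5 - v 2 * v 3) =
      (l * m' + m * l') * (l * m' - m * l') := by
    linear_combination (s * v 2 + t * v 5) * f1 + l' ^ 2 * e3 - (s' * v 2 + t' * v 5) * e1 -
      l ^ 2 * f3
  have k3 : (s * t' - t * s') * (v 1 * v 5 - v 2 * v 4) = 2 * m * m' * (l * m' - m * l') := by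
    linear_combination (s * v 2 + t * v 5) * f2 + 2 * l' * m' * e3 -
      (s' * v 2 + t' * v 5) * e2 - 2 * l * m * f3
  have hβ : l * m' - m * l' ≠ 0 := by
    intro h
    rw [h, mul_zero] at k1 k2 k3
    have j1 := (mul_eq_zero.1 k1).resolve_left hN
    have j2 := (mul_eq_zero.1 k2).resolve_left hN
    exact hv (by rw [resVec, quadRes, j1, j2]; ring)
  refine ⟨(mkGL s t s' t' hN)⁻¹, mkGL l m l' m' hβ, fun z => ?_, fun z => ?_⟩
  · obtain ⟨x, y, hxy, rfl⟩ := exists_eq_ratio z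
    rw [eq_inv_smul_iff, hmap x y hxy, mkGL_smul_ratio _ (forms_ne_zero hv hxy),
      mkGL_smul_ratio _ hxy, sqMap_ratio]
    congr 1 <;> simp only [numForm, denForm]
    · linear_combination -x ^ 2 * e1 - x * y * e2 - y ^ 2 * e3
    · linear_combination -x ^ 2 * f1 - x * y * f2 - y ^ 2 * f3
  · obtain ⟨x, y, hxy, rfl⟩ := exists_eq_ratio z
    have hw : (s * t' - t * s') * wronskianForm v x y =
        2 * (l * m' - m * l') * ((l * x + m * y) * (l' * x + m' * y)) := by
      rw [wronskianForm]
      linear_combination x ^ 2 * k1 + 2 * x * y * k2 + y ^ 2 * k3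
    have hne : l * x + m * y ≠ 0 ∨ l' * x + m' * y ≠ 0 := linear_ne_zero (mkGL l m l' m' hβ) hxy
    rw [hcrit x y hxy, mkGL_smul_ratio _ hxy, ratio_eq_ratio_iff hne (by simp),
      ratio_eq_ratio_iff hne (by simp), ← mul_right_inj' hN, hw]
    simp [hβ, eq_comm]

lemma sqMap_smul_eq {z : Sphere} (h : z = ratio 0 1 ∨ z = ratio 1 0) : sqMap z = z := by
  rcases h with rfl | rfl <;> rw [sqMap_ratio] <;> norm_num

lemma smul_mem_criticalValues {A : RatFunc ℂ} {α β : GL (Fin 2) ℂ}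
    (h : ∀ z, toMap A z = α • sqMap (β • z))
    (hc : ∀ z, z ∈ criticalPoints A ↔ β • z = ratio 0 1 ∨ β • z = ratio 1 0) (x : Sphere)
    (hx : x = ratio 0 1 ∨ x = ratio 1 0) : α • x ∈ criticalValues A :=
  ⟨β⁻¹ • x, (hc _).2 (by rwa [smul_inv_smul]), by rw [h, smul_inv_smul, sqMap_smul_eq hx]⟩

/-- The statement for every rational function of degree two. -/
theorem symmetry_of_ratDegree_two {A : RatFunc ℂ} (hA : ratDegree A = 2) :
    muA A ≠ 1 ∧ (symmetryGroup (toMap A) : Set (Equiv.Perm Sphere)) = {1, muA A} ∧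
      (muA A '' criticalValues A ∩ criticalValues A = ∅ →
        symmetryInfty A = symmetryGroup (toMap A)) := by
  obtain ⟨α, β, h, hc⟩ := exists_normalForm hA
  refine ⟨?_, ?_, symmetryInfty_eq h (smul_mem_criticalValues h hc)⟩
  · rw [muA_eq h]
    exact mobiusPerm_deckGL_ne_one β
  · rw [muA_eq h, symmetryGroup_eq h]

/-! ## The open set cut out by resultants -/

section Forms

variable {R : Type*} [CommRing R] (v : Fin 6 → R)

/-- The entries of the matrix of `μ_A`. -/
def muEntry : Fin 2 → Fin 2 → R :=
  ![![v 2 * v 3 - v 0 * v 5, v 2 * v 4 - v 1 * v 5], ![v 0 * v 4 - v 1 * v 3, v 0 * v 5 - v 2 * v 3]]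

/-- The coefficients of the polynomial `R(t)`. -/
def coeffR : Fin 3 → R :=
  ![-(resVec v * (v 1 ^ 2 - 4 * (v 0 * v 2))),
    resVec v * (2 * (v 1 * v 4) - 4 * (v 0 * v 5) - 4 * (v 2 * v 3)),
    -(resVec v * (v 4 ^ 2 - 4 * (v 3 * v 5)))]

/-- The coefficients of the polynomial `S(t)`. -/
def coeffS : Fin 3 → R :=
  ![coeffR v 2 * muEntry v 0 1 ^ 2 - coeffR v 1 * (muEntry v 0 1 * muEntry v 0 0) +
      coeffR v 0 * muEntry v 0 0 ^ 2,
    coeffR v 1 * (muEntry v 0 1 * muEntry v 1 0 + muEntry v 1 1 * muEntry v 0 0) -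
      2 * (coeffR v 2 * (muEntry v 0 1 * muEntry v 1 1)) -
      2 * (coeffR v 0 * (muEntry v 0 0 * muEntry v 1 0)),
    coeffR v 2 * muEntry v 1 1 ^ 2 - coeffR v 1 * (muEntry v 1 1 * muEntry v 1 0) +
      coeffR v 0 * muEntry v 1 0 ^ 2]

/-- The resultant `Res_{2,2}(R, S)`. -/
def resRS : R :=
  quadRes (coeffR v 2) (coeffR v 1) (coeffR v 0) (coeffS v 2) (coeffS v 1) (coeffS v 0)

end Forms

lemma coeff_quadratic {R : Type*} [CommRing R] (a b c : R) :
    (C a * X ^ 2 + C b * X + C c : R[X]).coeff 2 = a ∧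
      (C a * X ^ 2 + C b * X + C c : R[X]).coeff 1 = b ∧
      (C a * X ^ 2 + C b * X + C c : R[X]).coeff 0 = c := by
  refine ⟨?_, ?_, ?_⟩ <;> simp [coeff_X, coeff_C]

lemma wronskianPoly_eq (v : Fin 6 → ℂ) : wronskianPoly v =
    C (v 0 * v 4 - v 1 * v 3) * X ^ 2 + C (2 * (v 0 * v 5 - v 2 * v 3)) * X +
      C (v 1 * v 5 - v 2 * v 4) := by
  have h2 : (C 2 : ℂ[X]) = 2 := map_ofNat C 2
  simp only [wronskianPoly, numPoly, denPoly, derivative_add, derivative_mul, derivative_C,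
    derivative_X_pow, derivative_X, C_sub, C_mul, h2]
  simp [h2]
  ring

/-- The coefficients show that `R(t)` is `-Res(P, Q)` times the discriminant of `P - t Q`. -/
lemma polyR_eq (v : Fin 6 → ℂ) :
    polyR v = C (coeffR v 2) * X ^ 2 + C (coeffR v 1) * X + C (coeffR v 0) := by
  have h2 : (C 2 : ℂ[X]) = 2 := map_ofNat C 2
  have h4 : (C 4 : ℂ[X]) = 4 := map_ofNat C 4
  have hw := coeff_quadratic (v 0 * v 4 - v 1 * v 3) (2 * (v 0 * v 5 - v 2 * v 3))
    (v 1 * v 5 - v 2 * v 4)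
  have hn := coeff_quadratic (v 0) (v 1) (v 2)
  have hd := coeff_quadratic (v 3) (v 4) (v 5)
  rw [polyR, resultant_two_two]
  simp only [coeff_sub, coeff_map, coeff_C_mul, wronskianPoly_eq, numPoly, denPoly, hw, hn, hd]
  simp [coeffR, resVec, quadRes, h2, h4]
  ring

lemma polyS_eq (v : Fin 6 → ℂ) :
    polyS v = C (coeffS v 2) * X ^ 2 + C (coeffS v 1) * X + C (coeffS v 0) := by
  have h2 : (C 2 : ℂ[X]) = 2 := map_ofNat C 2
  have hR := coeff_quadratic (coeffR v 2) (coeffR v 1) (coeffR v 0)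
  rw [polyS, resultant_two_one, polyR_eq]
  simp only [coeff_map, hR]
  simp [muNum, muDen, coeff_C, coeffS, h2]
  simp [muEntry]
  ring

lemma resultant_polyR_polyS (v : Fin 6 → ℂ) : resultant (polyR v) (polyS v) 2 2 = resRS v := by
  rw [resultant_two_two, polyR_eq, polyS_eq, resRS]
  simp [coeff_X, coeff_C]

/-! ### Homogeneity -/

section Homogeneous

open MvPolynomial

/-- The generic sextuple of coefficients. -/
noncomputable def genericVec : Fin 6 → MvPolynomial (Fin 6) ℂ := MvPolynomial.X

lemma isHomogeneous_mul_coords (i j : Fin 6) :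
    (genericVec i * genericVec j).IsHomogeneous 2 :=
  (isHomogeneous_X ℂ i).mul (isHomogeneous_X ℂ j)

lemma isHomogeneous_quadRes {a b c d e f : MvPolynomial (Fin 6) ℂ} {m n : ℕ}
    (ha : a.IsHomogeneous m) (hb : b.IsHomogeneous m) (hc : c.IsHomogeneous m)
    (hd : d.IsHomogeneous n) (he : e.IsHomogeneous n) (hf : f.IsHomogeneous n) :
    (quadRes a b c d e f).IsHomogeneous ((m + n) * 2) := by
  refine IsHomogeneous.sub (((ha.mul hf).sub (hc.mul hd)).pow 2) ?_
  rw [mul_two]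
  exact ((ha.mul he).sub (hb.mul hd)).mul ((hb.mul hf).sub (hc.mul he))

lemma IsHomogeneous.ofNat_mul {p : MvPolynomial (Fin 6) ℂ} {n : ℕ} (hp : p.IsHomogeneous n)
    (k : ℕ) [k.AtLeastTwo] : (OfNat.ofNat k * p).IsHomogeneous n := by
  rw [← map_ofNat (C : ℂ →+* MvPolynomial (Fin 6) ℂ) k, ← zero_add n]
  exact (isHomogeneous_C _ _).mul hp

lemma isHomogeneous_coeffR (i : Fin 3) : (coeffR genericVec i).IsHomogeneous 6 := by
  have hr : (resVec genericVec).IsHomogeneous 4 := by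
    have h := isHomogeneous_X ℂ (σ := Fin 6)
    exact isHomogeneous_quadRes (h 0) (h 1) (h 2) (h 3) (h 4) (h 5)
  have h := isHomogeneous_mul_coords
  have hs : ∀ i, (genericVec i ^ 2).IsHomogeneous 2 := fun i => by
    rw [sq]
    exact h i i
  fin_cases i
  · exact (hr.mul ((hs 1).sub (IsHomogeneous.ofNat_mul (h 0 2) 4))).neg
  · exact hr.mul (((IsHomogeneous.ofNat_mul (h 1 4) 2).sub
      (IsHomogeneous.ofNat_mul (h 0 5) 4)).sub (IsHomogeneous.ofNat_mul (h 2 3) 4))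
  · exact (hr.mul ((hs 4).sub (IsHomogeneous.ofNat_mul (h 3 5) 4))).neg

lemma isHomogeneous_muEntry (i j : Fin 2) : (muEntry genericVec i j).IsHomogeneous 2 := by
  have h := isHomogeneous_mul_coords
  fin_cases i <;> fin_cases j
  · exact (h 2 3).sub (h 0 5)
  · exact (h 2 4).sub (h 1 5)
  · exact (h 0 4).sub (h 1 3)
  · exact (h 0 5).sub (h 2 3)

lemma isHomogeneous_coeffS (i : Fin 3) : (coeffS genericVec i).IsHomogeneous 10 := by
  have hR := isHomogeneous_coeffR
  have h := isHomogeneous_muEntry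
  have hm : ∀ i j k l, (muEntry genericVec i j * muEntry genericVec k l).IsHomogeneous 4 :=
    fun i j k l => (h i j).mul (h k l)
  have hs : ∀ i j, (muEntry genericVec i j ^ 2).IsHomogeneous 4 := fun i j => by
    rw [sq]
    exact hm i j i j
  fin_cases i
  · exact (((hR 2).mul (hs 0 1)).sub ((hR 1).mul (hm 0 1 0 0))).add ((hR 0).mul (hs 0 0))
  · exact (((hR 1).mul ((hm 0 1 1 0).add (hm 1 1 0 0))).sub
      (IsHomogeneous.ofNat_mul ((hR 2).mul (hm 0 1 1 1)) 2)).sub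
      (IsHomogeneous.ofNat_mul ((hR 0).mul (hm 0 0 1 0)) 2)
  · exact (((hR 2).mul (hs 1 1)).sub ((hR 1).mul (hm 1 1 1 0))).add ((hR 0).mul (hs 1 0))

lemma isHomogeneous_resRS : (resRS genericVec).IsHomogeneous 32 :=
  isHomogeneous_quadRes (isHomogeneous_coeffR 2) (isHomogeneous_coeffR 1) (isHomogeneous_coeffR 0)
    (isHomogeneous_coeffS 2) (isHomogeneous_coeffS 1) (isHomogeneous_coeffS 0)

lemma map_quadRes {R S : Type*} [CommRing R] [CommRing S] (φ : R →+* S) (a b c d e f : R) :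
    φ (quadRes a b c d e f) = quadRes (φ a) (φ b) (φ c) (φ d) (φ e) (φ f) := by
  simp [quadRes]

lemma map_coeffR {R S : Type*} [CommRing R] [CommRing S] (φ : R →+* S) (v : Fin 6 → R)
    (i : Fin 3) : φ (coeffR v i) = coeffR (φ ∘ v) i := by
  have h2 : φ 2 = 2 := map_ofNat φ 2
  have h4 : φ 4 = 4 := map_ofNat φ 4
  fin_cases i <;> simp [coeffR, resVec, map_quadRes, h2, h4]

lemma map_coeffS {R S : Type*} [CommRing R] [CommRing S] (φ : R →+* S) (v : Fin 6 → R)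
    (i : Fin 3) : φ (coeffS v i) = coeffS (φ ∘ v) i := by
  have h2 : φ 2 = 2 := map_ofNat φ 2
  fin_cases i <;> simp [coeffS, muEntry, map_coeffR, h2]

lemma map_resRS {R S : Type*} [CommRing R] [CommRing S] (φ : R →+* S) (v : Fin 6 → R) :
    φ (resRS v) = resRS (φ ∘ v) := by
  simp only [resRS, map_quadRes, map_coeffR, map_coeffS]

/-- The formulas make sense over every commutative ring, so the generic sextuple turns them into a
homogeneous polynomial that cuts out `Z`. -/
lemma eval_resRS (v : Fin 6 → ℂ) : MvPolynomial.eval v (resRS genericVec) = resRS v := by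
  rw [map_resRS]
  congr 1
  funext i
  simp [genericVec]

end Homogeneous

lemma muEntry_smul (k : ℂ) (v : Fin 6 → ℂ) (i j : Fin 2) :
    muEntry (k • v) i j = k ^ 2 * muEntry v i j := by
  fin_cases i <;> fin_cases j <;> simp [muEntry] <;> ring

lemma resVec_smul (k : ℂ) (v : Fin 6 → ℂ) : resVec (k • v) = k ^ 4 * resVec v := by
  simp [resVec, quadRes]
  ring

lemma coeffR_smul (k : ℂ) (v : Fin 6 → ℂ) (i : Fin 3) :
    coeffR (k • v) i = k ^ 6 * coeffR v i := by
  fin_cases i <;> simp [coeffR, resVec_smul] <;> ring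

lemma coeffS_smul (k : ℂ) (v : Fin 6 → ℂ) (i : Fin 3) :
    coeffS (k • v) i = k ^ 10 * coeffS v i := by
  fin_cases i <;> simp [coeffS, coeffR_smul, muEntry_smul] <;> ring

/-- Representatives of projective points, and coefficients in lowest terms, are known only up to a
nonzero scalar. -/
lemma resRS_smul (k : ℂ) (v : Fin 6 → ℂ) : resRS (k • v) = k ^ 32 * resRS v := by
  simp only [resRS, quadRes, coeffR_smul, coeffS_smul]
  ring

/-! ### The explicit formula for `μ_A` and disjointness of the critical values -/

lemma det_muEntry (v : Fin 6 → ℂ) :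
    muEntry v 0 0 * muEntry v 1 1 - muEntry v 0 1 * muEntry v 1 0 = -resVec v := by
  simp [muEntry, resVec, quadRes]
  ring

/-- The matrix comes from dividing `P(x) Q(y) - P(y) Q(x)` by `x - y`: the quotient `(ae - bd) x y +
(af - cd)(x + y) + (bf - ce)` vanishes exactly when `y` is the image of `x`. -/
lemma numForm_muEntry (v : Fin 6 → ℂ) (x y : ℂ) :
    numForm v (muEntry v 0 0 * x + muEntry v 0 1 * y) (muEntry v 1 0 * x + muEntry v 1 1 * y) =
      resVec v * numForm v x y := by
  simp [muEntry, resVec, quadRes, numForm]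
  ring

lemma denForm_muEntry (v : Fin 6 → ℂ) (x y : ℂ) :
    denForm v (muEntry v 0 0 * x + muEntry v 0 1 * y) (muEntry v 1 0 * x + muEntry v 1 1 * y) =
      resVec v * denForm v x y := by
  simp [muEntry, resVec, quadRes, denForm]
  ring

/-- The matrix of `μ_A` for a rational function with coefficients `v`. -/
noncomputable def muGL (v : Fin 6 → ℂ) (hv : resVec v ≠ 0) : GL (Fin 2) ℂ :=
  mkGL (muEntry v 0 0) (muEntry v 0 1) (muEntry v 1 0) (muEntry v 1 1)
    (by rwa [det_muEntry, neg_ne_zero])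

lemma muEntry_linear_ne_zero {v : Fin 6 → ℂ} (hv : resVec v ≠ 0) {x y : ℂ} (h : x ≠ 0 ∨ y ≠ 0) :
    muEntry v 0 0 * x + muEntry v 0 1 * y ≠ 0 ∨ muEntry v 1 0 * x + muEntry v 1 1 * y ≠ 0 :=
  linear_ne_zero (muGL v hv) h

lemma muA_eq_muGL {A : RatFunc ℂ} (hA : ratDegree A = 2) :
    muA A = mobiusPerm (muGL (coeffVec A) (resVec_coeffVec_ne_zero hA)) := by
  have hv := resVec_coeffVec_ne_zero hA
  have hmem : mobiusPerm (muGL (coeffVec A) hv) ∈ symmetryGroup (toMap A) := by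
    refine mem_symmetryGroup_iff.2 ⟨_, rfl, fun z => ?_⟩
    obtain ⟨x, y, h, rfl⟩ := exists_eq_ratio z
    have hne := muEntry_linear_ne_zero hv h
    rw [muGL, mkGL_smul_ratio _ h, toMap_ratio hA hne, toMap_ratio hA h, numForm_muEntry,
      denForm_muEntry, ratio_mul_left hv]
  rw [← SetLike.mem_coe, (symmetry_of_ratDegree_two hA).2.1] at hmem
  rcases hmem with h | h
  · exfalso
    have hfix : ∀ z : Sphere, muGL (coeffVec A) hv • z = z := fun z => DFunLike.congr_fun h z
    have hne := fun x y h => muEntry_linear_ne_zero hv (x := x) (y := y) h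
    have key : ∀ x y : ℂ, (x ≠ 0 ∨ y ≠ 0) →
        (muEntry (coeffVec A) 0 0 * x + muEntry (coeffVec A) 0 1 * y) * y =
          x * (muEntry (coeffVec A) 1 0 * x + muEntry (coeffVec A) 1 1 * y) := fun x y hxy => by
      have h1 := hfix (ratio x y)
      rwa [muGL, mkGL_smul_ratio _ hxy, ratio_eq_ratio_iff (hne x y hxy) hxy] at h1
    have h1 := key 1 0 (by simp)
    have h2 := key 0 1 (by simp)
    have h3 := key 1 1 (by simp)
    -- The matrix has trace zero. If it acted trivially it would be scalar, hence zero, against the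
    -- nonvanishing determinant.
    have h4 : muEntry (coeffVec A) 0 0 = -muEntry (coeffVec A) 1 1 := by simp [muEntry]
    have h5 : muEntry (coeffVec A) 1 1 = 0 := by
      linear_combination (-1 / 2 : ℂ) * h3 + (1 / 2 : ℂ) * h4 + (1 / 2 : ℂ) * h2 +
        (1 / 2 : ℂ) * h1
    refine hv ?_
    rw [← neg_eq_zero, ← det_muEntry, h5]
    linear_combination -muEntry (coeffVec A) 1 0 * h2
  · exact h.symm

/-- The polynomial `R` as a binary form. -/
noncomputable def formR (v : Fin 6 → ℂ) (x y : ℂ) : ℂ :=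
  coeffR v 2 * x ^ 2 + coeffR v 1 * x * y + coeffR v 0 * y ^ 2

/-- The polynomial `S` as a binary form. -/
noncomputable def formS (v : Fin 6 → ℂ) (x y : ℂ) : ℂ :=
  coeffS v 2 * x ^ 2 + coeffS v 1 * x * y + coeffS v 0 * y ^ 2

/-- The critical values are zeros of `R`. -/
lemma formR_values (v : Fin 6 → ℂ) (x y : ℂ) :
    formR v (numForm v x y) (denForm v x y) = -resVec v * wronskianForm v x y ^ 2 := by
  simp [formR, coeffR, numForm, denForm, wronskianForm]
  ring

/-- The images of the zeros of `R` under `μ_A` are zeros of `S`. -/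
lemma formS_muEntry (v : Fin 6 → ℂ) (x y : ℂ) :
    formS v (muEntry v 0 0 * x + muEntry v 0 1 * y) (muEntry v 1 0 * x + muEntry v 1 1 * y) =
      resVec v ^ 2 * formR v x y := by
  -- `S` is the form `R` composed with the adjugate of the matrix of `μ_A`, so composing with the
  -- matrix rescales the variables by its determinant.
  rw [← neg_sq, ← det_muEntry]
  simp [formS, formR, coeffS]
  ring

lemma formR_mul (v : Fin 6 → ℂ) (k x y : ℂ) : formR v (k * x) (k * y) = k ^ 2 * formR v x y := by
  simp only [formR]
  ring

lemma exists_of_mem_criticalValues {A : RatFunc ℂ} (hA : ratDegree A = 2) {w : Sphere}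
    (hw : w ∈ criticalValues A) :
    ∃ x y : ℂ, (x ≠ 0 ∨ y ≠ 0) ∧ w = ratio x y ∧ formR (coeffVec A) x y = 0 := by
  obtain ⟨z, hz, rfl⟩ := hw
  obtain ⟨x, y, h, rfl⟩ := exists_eq_ratio z
  rw [ratio_mem_criticalPoints_iff hA h] at hz
  refine ⟨_, _, forms_ne_zero (resVec_coeffVec_ne_zero hA) h, toMap_ratio hA h, ?_⟩
  rw [formR_values, hz]
  ring

theorem disjoint_criticalValues {A : RatFunc ℂ} (hA : ratDegree A = 2)
    (h : resRS (coeffVec A) ≠ 0) : muA A '' criticalValues A ∩ criticalValues A = ∅ := by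
  rw [Set.eq_empty_iff_forall_notMem]
  rintro w ⟨⟨w', hw', hw''⟩, hw⟩
  obtain ⟨x, y, hxy, rfl, hR⟩ := exists_of_mem_criticalValues hA hw'
  obtain ⟨x', y', hxy', rfl, hR'⟩ := exists_of_mem_criticalValues hA hw
  have hv := resVec_coeffVec_ne_zero hA
  have hne := muEntry_linear_ne_zero hv hxy
  rw [muA_eq_muGL hA, mobiusPerm_apply, muGL, mkGL_smul_ratio _ hxy,
    ratio_eq_ratio_iff hne hxy'] at hw''
  have hS := formS_muEntry (coeffVec A) x y
  rw [hR, mul_zero] at hS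
  refine h (quadRes_eq_zero hne ?_ hS)
  change _ * y' = x' * _ at hw''
  change formR (coeffVec A) (muEntry (coeffVec A) 0 0 * x + muEntry (coeffVec A) 0 1 * y)
    (muEntry (coeffVec A) 1 0 * x + muEntry (coeffVec A) 1 1 * y) = 0
  set s := muEntry (coeffVec A) 0 0 * x + muEntry (coeffVec A) 0 1 * y
  set t := muEntry (coeffVec A) 1 0 * x + muEntry (coeffVec A) 1 1 * y
  -- `(s, t)` and `(x', y')` are proportional; multiplying by a nonzero coordinate of `(x', y')`
  -- transfers the zero of `R`.
  rcases hxy' with hx | hy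
  · have e := formR_mul (coeffVec A) x' s t
    rw [← hw'', mul_comm x' s, formR_mul, hR', mul_zero] at e
    exact (mul_eq_zero.1 e.symm).resolve_left (pow_ne_zero 2 hx)
  · have e := formR_mul (coeffVec A) y' s t
    rw [mul_comm y' s, hw'', mul_comm y' t, mul_comm x' t, formR_mul, hR', mul_zero] at e
    exact (mul_eq_zero.1 e.symm).resolve_left (pow_ne_zero 2 hy)

/-! ### Points of `Rat₂` -/

lemma isCoprime_of_resVec_ne_zero {v : Fin 6 → ℂ} (hv : resVec v ≠ 0) :
    IsCoprime (numPoly v) (denPoly v) := by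
  obtain ⟨p, q, -, -, h⟩ := exists_mul_add_mul_eq_C_resultant (m := 2) (n := 2) (numPoly v)
    (denPoly v) natDegree_quadratic_le natDegree_quadratic_le (by simp)
  rw [resultant_numPoly_denPoly] at h
  have hC : C (resVec v)⁻¹ * C (resVec v) = (1 : ℂ[X]) := by
    rw [← C_mul, inv_mul_cancel₀ hv, C_1]
  exact ⟨C (resVec v)⁻¹ * p, C (resVec v)⁻¹ * q, by
    linear_combination C (resVec v)⁻¹ * h + hC⟩

lemma denPoly_ne_zero {v : Fin 6 → ℂ} (hv : resVec v ≠ 0) : denPoly v ≠ 0 := by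
  intro h
  obtain ⟨h2, h1, h0⟩ := coeff_quadratic (v 3) (v 4) (v 5)
  change (denPoly v).coeff 2 = _ at h2
  change (denPoly v).coeff 1 = _ at h1
  change (denPoly v).coeff 0 = _ at h0
  rw [h, coeff_zero] at h0 h1 h2
  refine hv ?_
  rw [resVec, quadRes, ← h0, ← h1, ← h2]
  ring

/-- `P` and `Q` are coprime, so the fraction is already in lowest terms; the scalar `k` accounts for
the normalisation of the denominator. -/
lemma exists_num_denom_ratOfVec {v : Fin 6 → ℂ} (hv : resVec v ≠ 0) : ∃ k : ℂ, k ≠ 0 ∧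
    (ratOfVec v).num = C k * numPoly v ∧ (ratOfVec v).denom = C k * denPoly v := by
  have hQ := denPoly_ne_zero hv
  have hcop := isCoprime_of_resVec_ne_zero hv
  have hmul : (ratOfVec v).num * denPoly v = numPoly v * (ratOfVec v).denom :=
    (RatFunc.num_mul_eq_mul_denom_iff hQ).2 rfl
  obtain ⟨u, hu⟩ := associated_of_dvd_dvd
    (hcop.symm.dvd_of_dvd_mul_left (Dvd.intro_left _ hmul))
    ((ratOfVec v).isCoprime_num_denom.symm.dvd_of_dvd_mul_left (Dvd.intro_left _ hmul.symm))
  obtain ⟨k, hk, hk'⟩ := Polynomial.isUnit_iff.1 u.isUnit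
  refine ⟨k, hk.ne_zero, ?_, ?_⟩
  · rw [← hu, ← hk'] at hmul
    exact mul_right_cancel₀ hQ (by linear_combination hmul)
  · rw [← hu, ← hk', mul_comm]

lemma coeffVec_ratOfVec {v : Fin 6 → ℂ} (hv : resVec v ≠ 0) :
    ∃ k : ℂ, k ≠ 0 ∧ coeffVec (ratOfVec v) = k • v := by
  obtain ⟨k, hk, hn, hd⟩ := exists_num_denom_ratOfVec hv
  have h1 := coeff_quadratic (v 0) (v 1) (v 2)
  have h2 := coeff_quadratic (v 3) (v 4) (v 5)
  refine ⟨k, hk, funext fun i => ?_⟩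
  fin_cases i <;> simp [coeffVec, hn, hd, numPoly, denPoly, h1, h2, -map_mul]

lemma ratDegree_ratOfVec {v : Fin 6 → ℂ} (hv : resVec v ≠ 0) : ratDegree (ratOfVec v) = 2 := by
  obtain ⟨k, hk, hn, hd⟩ := exists_num_denom_ratOfVec hv
  rw [ratDegree, hn, hd, natDegree_C_mul hk, natDegree_C_mul hk]
  have hn2 : (numPoly v).natDegree ≤ 2 := natDegree_quadratic_le
  have hd2 : (denPoly v).natDegree ≤ 2 := natDegree_quadratic_le
  refine le_antisymm (max_le hn2 hd2) ?_
  have h03 : v 0 ≠ 0 ∨ v 3 ≠ 0 := by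
    by_contra! h
    refine hv ?_
    rw [resVec, quadRes, h.1, h.2]
    ring
  rcases h03 with h | h
  · exact le_max_of_le_left (natDegree_quadratic h).ge
  · exact le_max_of_le_right (natDegree_quadratic h).ge

lemma ratOf_eq (x : P5) : ratOf x = ratOfVec x.rep := by
  conv_lhs => rw [← x.mk_rep]
  rfl

lemma exists_rep_mk {v : Fin 6 → ℂ} (hv : v ≠ 0) :
    ∃ k : ℂ, k ≠ 0 ∧ (Projectivization.mk ℂ v hv).rep = k • v := by
  obtain ⟨a, ha⟩ := Projectivization.exists_smul_eq_mk_rep ℂ v hv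
  exact ⟨a, a.ne_zero, ha.symm⟩

lemma mem_Rat2_iff (x : P5) : x ∈ Rat2 ↔ resVec x.rep ≠ 0 := by
  rw [← resultant_numPoly_denPoly]
  rfl

lemma mem_setZ_iff (x : P5) : x ∈ setZ ↔ resRS x.rep = 0 := by
  rw [← resultant_polyR_polyS]
  rfl

lemma mk_mem_Rat2_iff {v : Fin 6 → ℂ} (hv : v ≠ 0) :
    Projectivization.mk ℂ v hv ∈ Rat2 ↔ resVec v ≠ 0 := by
  obtain ⟨k, hk, h⟩ := exists_rep_mk hv
  rw [mem_Rat2_iff, h, resVec_smul]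
  simp [hk]

lemma mk_mem_setL_union_setZ_iff {v : Fin 6 → ℂ} (hv : v ≠ 0) :
    Projectivization.mk ℂ v hv ∈ setL ∪ setZ ↔ (v 0 * v 4 - v 1 * v 3) * resRS v = 0 := by
  obtain ⟨k, hk, h⟩ := exists_rep_mk hv
  have hL : Projectivization.mk ℂ v hv ∈ setL ↔ v 0 * v 4 - v 1 * v 3 = 0 := by
    change (Projectivization.mk ℂ v hv).rep 0 * _ - _ = 0 ↔ _
    have e : k * v 0 * (k * v 4) - k * v 1 * (k * v 3) = k ^ 2 * (v 0 * v 4 - v 1 * v 3) := by ring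
    rw [h]
    simp only [Pi.smul_apply, smul_eq_mul]
    rw [e]
    simp [hk]
  rw [Set.mem_union, hL, mem_setZ_iff, h, resRS_smul, mul_eq_zero]
  simp [hk]

lemma isZariskiOpenInRat2 : IsZariskiOpenInRat2 (Rat2 \ (setL ∪ setZ)) := by
  refine ⟨_, ⟨{(genericVec 0 * genericVec 4 - genericVec 1 * genericVec 3) * resRS genericVec},
    ?_, fun v hv => ?_⟩, rfl⟩
  · rintro p rfl
    exact ⟨_, ((isHomogeneous_mul_coords 0 4).sub (isHomogeneous_mul_coords 1 3)).mul
      isHomogeneous_resRS⟩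
  · rw [mk_mem_setL_union_setZ_iff]
    simp only [Set.mem_singleton_iff, forall_eq, map_mul, eval_resRS]
    simp [genericVec]

/-- The function `z + 1 / z` belongs to the open set. -/
lemma nonempty_open_set : (Rat2 \ (setL ∪ setZ)).Nonempty := by
  have hv : (![1, 0, 1, 0, 1, 0] : Fin 6 → ℂ) ≠ 0 := fun h => by simpa using congrFun h 0
  refine ⟨Projectivization.mk ℂ _ hv, (mk_mem_Rat2_iff hv).2 ?_, fun h => ?_⟩
  · simp [resVec, quadRes]
  -- Here `μ_A` is `1 / z`, and it carries the critical values `±2` to `±1/2`.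
  · rw [mk_mem_setL_union_setZ_iff] at h
    simp [resRS, coeffR, coeffS, muEntry, resVec, quadRes] at h
    norm_num at h

end QuadRat

theorem theorem3p4 :
    -- the statement for every rational function of degree two
    (∀ A : RatFunc ℂ, ratDegree A = 2 →
      muA A ≠ 1 ∧
      (symmetryGroup (toMap A) : Set (Equiv.Perm Sphere)) = {1, muA A} ∧
      (muA A '' criticalValues A ∩ criticalValues A = ∅ →
        symmetryInfty A = symmetryGroup (toMap A))) ∧
    -- the hypothesis and the conclusion hold on a non-empty Zariski open subset of the variety
    IsZariskiOpenInRat2 (Rat2 \ (setL ∪ setZ)) ∧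
    (Rat2 \ (setL ∪ setZ)).Nonempty ∧
    (∀ x ∈ Rat2 \ (setL ∪ setZ),
      ratDegree (ratOf x) = 2 ∧
      muA (ratOf x) '' criticalValues (ratOf x) ∩ criticalValues (ratOf x) = ∅ ∧
      symmetryInfty (ratOf x) = symmetryGroup (toMap (ratOf x)) ∧
      symmetryInfty (ratOf x) = {1, muA (ratOf x)}) := by
  refine ⟨fun A hA => symmetry_of_ratDegree_two hA, isZariskiOpenInRat2, nonempty_open_set, ?_⟩
  rintro x ⟨hx, hxLZ⟩
  rw [mem_Rat2_iff] at hx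
  have hZ : resRS x.rep ≠ 0 := fun h => hxLZ (Or.inr ((mem_setZ_iff x).2 h))
  have hdeg := ratDegree_ratOfVec hx
  obtain ⟨k, hk, hvec⟩ := coeffVec_ratOfVec hx
  have hdisj := disjoint_criticalValues hdeg (by
    rw [hvec, resRS_smul]
    exact mul_ne_zero (pow_ne_zero _ hk) hZ)
  obtain ⟨-, hgroup, hinfty⟩ := symmetry_of_ratDegree_two hdeg
  rw [ratOf_eq]
  exact ⟨hdeg, hdisj, hinfty hdisj, (hinfty hdisj).trans hgroup⟩
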